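/- There is a constant $c>0$ such that the following holds for every integer $n\ge 1$. Consider an $n\times n$ input-queued switch in discrete time, started empty. It consists of $n^2$ queues $(i,j)$, $1\le i,j\le n$. In each time slot a scheduling policy, on the basis of the current and past queue sizes, chooses a schedule, i.e. a $0$-$1$ matrix $(\sigma_{ij})$ with at most one $1$ in each row and each column; one packet is then removed from every nonempty queue $(i,j)$ with $\sigma_{ij}=1$; at the end of the slot new packets arrive. The numbers of packets arriving to the different queues in the different slots are independent Bernoulli random variables with mean $\rho/n$, where $\rho=1-1/n$. Then there is a scheduling policy (which may depend on $n$) such that, at the beginning of every time slot $\tau$, the queue sizes $Q_{ij}(\tau)$ satisfy $$\mathbb{E}\Big[\sum_{i,j=1}^n Q_{ij}(\tau)\Big]\le c\,n^{7/3}\log n .$$ -/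

import Mathlib

open MeasureTheory ProbabilityTheory

/-- An `n × n` array of nonnegative integers indexed by (input, output) pairs: queue sizes,
numbers of arrivals in one time slot, or a schedule. -/
abbrev SwitchMatrix (n : ℕ) : Type := Matrix (Fin n) (Fin n) ℕ

/-- The feasible schedules of an `n × n` switch: `0`-`1` matrices with at most one `1` in every
row and in every column, i.e. the partial matchings between inputs and outputs. -/
def feasibleSchedules (n : ℕ) : Set (SwitchMatrix n) :=
  {σ | (∀ i j, σ i j = 0 ∨ σ i j = 1) ∧ (∀ i, ∑ j, σ i j ≤ 1) ∧ (∀ j, ∑ i, σ i j ≤ 1)}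

/-- A (deterministic, non-anticipating) scheduling policy. In every time slot it sees the current
queue sizes and the queue sizes at the beginning of all earlier slots (most recent first), and
chooses a feasible schedule. The current slot can be read off from the length of the past, and the
past schedules and the past arrivals are functions of the observed queue sizes. -/
structure SchedulingPolicy (n : ℕ) where
  /-- The schedule used when the current queue sizes and the past queue sizes are as given. -/
  schedule : (current : SwitchMatrix n) → (past : List (SwitchMatrix n)) → SwitchMatrix n
  feasible : ∀ current past, schedule current past ∈ feasibleSchedules n

namespace SchedulingPolicy

variable {n : ℕ} (π : SchedulingPolicy n) (x : ℕ → SwitchMatrix n)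

/-- The queue sizes at the beginning of slot `t` together with the list of those at the beginning
of the slots `t - 1, …, 0`, for the arrivals `x 0, x 1, …`. The switch starts empty. In each slot the
policy chooses a schedule, at most one packet is served from each scheduled queue (the subtraction
is truncated at `0`), and the arrivals `x t` of the slot join at its end. -/
def state : ℕ → SwitchMatrix n × List (SwitchMatrix n)
  | 0 => (0, [])
  | t + 1 =>
    (fun i j => ((state t).1 i j - π.schedule (state t).1 (state t).2 i j) + x t i j,
      (state t).1 :: (state t).2)

/-- The queue sizes at the beginning of slot `t`; slots are numbered from `0`. -/
def queue (t : ℕ) : SwitchMatrix n := (π.state x t).1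

/-- The queue sizes at the beginning of the slots before `t`, most recent first. -/
def past (t : ℕ) : List (SwitchMatrix n) := (π.state x t).2

theorem queue_zero : π.queue x 0 = 0 := rfl

theorem queue_succ (t : ℕ) (i j : Fin n) :
    π.queue x (t + 1) i j =
      (π.queue x t i j - π.schedule (π.queue x t) (π.past x t) i j) + x t i j := rfl

theorem past_zero : π.past x 0 = [] := rfl

theorem past_succ (t : ℕ) : π.past x (t + 1) = π.queue x t :: π.past x t := rfl

end SchedulingPolicy

/-- `a t ω i j` is the number of packets that arrive to queue `(i, j)` in slot `t`. The `n ^ 2`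
arrival streams are independent Bernoulli processes of rate `p`: all these numbers are independent,
and each is `1` with probability `p` and `0` with probability `1 - p`. -/
structure IsBernoulliArrivals {n : ℕ} {Ω : Type*} [MeasurableSpace Ω] (P : Measure Ω)
    (p : unitInterval) (a : ℕ → Ω → SwitchMatrix n) : Prop where
  hasLaw : ∀ t i j, HasLaw (fun ω => a t ω i j) (bernoulliMeasure 1 0 p) P
  indep : iIndepFun (fun (k : ℕ × Fin n × Fin n) ω => a k.1 ω k.2.1 k.2.2) P

/-! The policy works on batches of `M` intervals of `d` slots, with `M` of order n^(2/3) and `d` of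
order n^(4/3) log n. The arrivals of one interval form a bipartite multigraph of mean degree ρd.
With high probability it contains a `k`-factor, where `k` is about ρd - δ and δ is of order √(d log
n). A `k`-factor splits into `k` perfect matchings, so it is served in `k` slots without any waste.

Service starts with a delay of d + M(d - k) slots, just enough for every interval to be complete
before its factor is served. A batch also spans Md slots of service: the factors take Mk of them,
and the other M(d - k) remove the unfactored packets by matchings that each lower the maximal row or
column sum. This empties the batch if all its row and column sums stay below Md. Their mean is Md -
Md/n, so this is likely once Md is of order n² log n.

In a good batch the queues then hold about as many packets as arrive during the delay, O(n(d + M(d -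
k))). Since M(d - k) is about Md/n + Mδ, with Md of order n² log n the sum d + Mδ is balanced at d
of order n^(4/3) log n, which gives n^(7/3) log n. Bad batches have probability O(n^(-59)); an
exponential Lyapunov function shows that the backlog they cause is negligible.

The main supports are `FactorCondition.exists_factor` and `exists_critical_matching`
(combinatorics), `prob_not_factorCondition_le` (a union bound over Ore pairs),
`queue_add_sum_batchSchedule` (no scheduled service is lost) and `integral_lyapunov_le` (drift). -/

/-! ### Factors and critical matchings in bipartite multigraphs. -/

section Combinatorics

variable {n : ℕ}

/-- The number of packets in the queues `(i, j)` with `i ∈ I` and `j ∈ J`. -/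
def blockSum (A : SwitchMatrix n) (I J : Finset (Fin n)) : ℕ := ∑ i ∈ I, ∑ j ∈ J, A i j

theorem blockSum_eq_ite (A : SwitchMatrix n) (I J : Finset (Fin n)) :
    blockSum A I J = ∑ i, ∑ j, if i ∈ I ∧ j ∈ J then A i j else 0 := by
  classical
  simp only [blockSum, ite_and, Finset.sum_ite_irrel, Finset.sum_const_zero, Finset.sum_ite_mem,
    Finset.univ_inter]

/-- Entry by entry, a pair lies in the two uncrossed blocks at most as often as in the two original
ones. This submodularity makes tight pairs of sets uncross. -/
theorem blockSum_uncross (A : SwitchMatrix n) (I₁ I₂ J₁ J₂ : Finset (Fin n)) :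
    blockSum A (I₁ ∩ I₂) (J₁ ∪ J₂) + blockSum A (I₁ ∪ I₂) (J₁ ∩ J₂) ≤
      blockSum A I₁ J₁ + blockSum A I₂ J₂ := by
  simp only [blockSum_eq_ite, ← Finset.sum_add_distrib]
  refine Finset.sum_le_sum fun i _ => Finset.sum_le_sum fun j _ => ?_
  by_cases h1 : i ∈ I₁ <;> by_cases h2 : i ∈ I₂ <;> by_cases h3 : j ∈ J₁ <;>
    by_cases h4 : j ∈ J₂ <;> simp [h1, h2, h3, h4]

/-- The condition of Hall and Ore for a `k`-factor in the bipartite multigraph with adjacency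
matrix `A`. -/
def FactorCondition (A : SwitchMatrix n) (k : ℕ) : Prop :=
  ∀ I J : Finset (Fin n), k * (I.card + J.card) ≤ blockSum A I J + k * n

/-- All rows and all columns of `G` sum to `k`. -/
def RegularMatrix (G : SwitchMatrix n) (k : ℕ) : Prop :=
  (∀ i, ∑ j, G i j = k) ∧ ∀ j, ∑ i, G i j = k

/-- The pairs ({i}, all) and (all, {j}) force every row and column sum to be at least `k`; comparing
totals leaves no slack in the columns. -/
theorem regularMatrix_of_row_le {A : SwitchMatrix n} {k : ℕ} (hA : FactorCondition A k)
    (hrow : ∀ i, ∑ j, A i j ≤ k) : RegularMatrix A k := by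
  have hrow' : ∀ i, ∑ j, A i j = k := fun i => by
    have h := hA {i} Finset.univ
    simp only [blockSum, Finset.sum_singleton, Finset.card_singleton, Finset.card_univ,
      Fintype.card_fin] at h
    have := hrow i
    nlinarith
  refine ⟨hrow', ?_⟩
  have hcol : ∀ j ∈ Finset.univ, k ≤ ∑ i, A i j := fun j _ => by
    have h := hA Finset.univ {j}
    simp only [blockSum, Finset.sum_singleton, Finset.card_singleton, Finset.card_univ,
      Fintype.card_fin] at h
    nlinarith
  have htot : ∑ _j : Fin n, k = ∑ j, ∑ i, A i j := by
    rw [Finset.sum_comm]; simp [hrow']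
  exact fun j => ((Finset.sum_eq_sum_iff_of_le hcol).1 htot j (Finset.mem_univ j)).symm

theorem exists_tight_of_row {A : SwitchMatrix n} {k : ℕ} (hA : FactorCondition A k) (i : Fin n)
    (ht : ∀ j, 0 < A i j → ∃ I J : Finset (Fin n), i ∈ I ∧ j ∈ J ∧
      k * (I.card + J.card) = blockSum A I J + k * n) (s : Finset (Fin n))
    (hs : ∀ j ∈ s, 0 < A i j) :
    ∃ I J : Finset (Fin n), i ∈ I ∧ s ⊆ J ∧ k * (I.card + J.card) = blockSum A I J + k * n := by
  classical
  induction s using Finset.induction_on with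
  -- The pair (all inputs, no outputs) is always tight.
  | empty => exact ⟨Finset.univ, ∅, by simp, by simp, by simp [blockSum]⟩
  | insert j s hj ih =>
    obtain ⟨I₁, J₁, hi₁, hs₁, h₁⟩ := ih fun j hj => hs j (Finset.mem_insert_of_mem hj)
    obtain ⟨I₂, J₂, hi₂, hj₂, h₂⟩ := ht j (hs j (Finset.mem_insert_self j s))
    refine ⟨I₁ ∩ I₂, J₁ ∪ J₂, Finset.mem_inter.2 ⟨hi₁, hi₂⟩, ?_, ?_⟩
    · exact Finset.insert_subset (Finset.mem_union_right _ hj₂)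
        (hs₁.trans Finset.subset_union_left)
    -- The demand side is modular and block sums are submodular, so both uncrossed pairs are tight
    -- again.
    · have hu := blockSum_uncross A I₁ I₂ J₁ J₂
      have e₁ := hA (I₁ ∩ I₂) (J₁ ∪ J₂)
      have e₂ := hA (I₁ ∪ I₂) (J₁ ∩ J₂)
      have c₁ := Finset.card_union_add_card_inter I₁ I₂
      have c₂ := Finset.card_union_add_card_inter J₁ J₂
      have hk : k * ((I₁ ∩ I₂).card + (J₁ ∪ J₂).card) + k * ((I₁ ∪ I₂).card + (J₁ ∩ J₂).card) =
          k * (I₁.card + J₁.card) + k * (I₂.card + J₂.card) := by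
        rw [← mul_add, ← mul_add]; congr 1; omega
      omega

theorem blockSum_erase_le (A : SwitchMatrix n) {i : Fin n} {I J : Finset (Fin n)} (hi : i ∈ I)
    (hJ : ∀ j, 0 < A i j → j ∈ J) :
    blockSum A (I.erase i) J + ∑ j, A i j = blockSum A I J := by
  rw [blockSum, blockSum, ← Finset.sum_erase_add _ _ hi]
  congr 1
  refine (Finset.sum_subset (Finset.subset_univ J) fun j _ hj => ?_).symm
  by_contra h
  exact hj (hJ j (Nat.pos_of_ne_zero h))

/-- A bipartite multigraph that satisfies the condition of Hall and Ore has a `k`-factor. -/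
theorem FactorCondition.exists_factor {A : SwitchMatrix n} {k : ℕ} (hA : FactorCondition A k) :
    ∃ G : SwitchMatrix n, (∀ i j, G i j ≤ A i j) ∧ RegularMatrix G k := by
  classical
  obtain ⟨N, hN⟩ : ∃ N, ∑ i, ∑ j, A i j = N := ⟨_, rfl⟩
  induction N using Nat.strong_induction_on generalizing A with
  | _ N ih =>
    by_cases hrow : ∀ i, ∑ j, A i j ≤ k
    · exact ⟨A, fun _ _ => le_rfl, regularMatrix_of_row_le hA hrow⟩
    push Not at hrow
    obtain ⟨i, hi⟩ := hrow
    let E : Fin n → SwitchMatrix n := fun j => fun i' j' => if i' = i ∧ j' = j then 1 else 0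
    -- Delete an edge at the overfull vertex `i` as long as the condition survives.
    by_cases hdec : ∃ j, 0 < A i j ∧ FactorCondition (fun i' j' => A i' j' - E j i' j') k
    · obtain ⟨j, hj, hc⟩ := hdec
      have hlt : ∑ i', ∑ j', (A i' j' - E j i' j') < N := by
        rw [← hN]
        refine Finset.sum_lt_sum (fun i' _ => Finset.sum_le_sum fun j' _ => Nat.sub_le _ _)
          ⟨i, Finset.mem_univ i, ?_⟩
        refine Finset.sum_lt_sum (fun j' _ => Nat.sub_le _ _) ⟨j, Finset.mem_univ j, ?_⟩
        simp only [E, and_self, if_true]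
        omega
      obtain ⟨G, hG, hr⟩ := ih _ hlt hc rfl
      exact ⟨G, fun i' j' => (hG i' j').trans (Nat.sub_le _ _), hr⟩
    · exfalso
      push Not at hdec
      have htight : ∀ j, 0 < A i j → ∃ I J : Finset (Fin n), i ∈ I ∧ j ∈ J ∧
          k * (I.card + J.card) = blockSum A I J + k * n := by
        intro j hj
        have := hdec j hj
        simp only [FactorCondition, not_forall, not_le] at this
        obtain ⟨I, J, hIJ⟩ := this
        have hsplit : blockSum A I J =
            blockSum (fun i' j' => A i' j' - E j i' j') I J + if i ∈ I ∧ j ∈ J then 1 else 0 := by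
          have : (if i ∈ I ∧ j ∈ J then 1 else 0) = blockSum (E j) I J := by
            simp only [blockSum, E, ite_and, Finset.sum_ite_irrel, Finset.sum_const_zero,
              Finset.sum_ite_eq']
          rw [this]
          unfold blockSum
          rw [← Finset.sum_add_distrib]
          refine Finset.sum_congr rfl fun i' _ => ?_
          rw [← Finset.sum_add_distrib]
          refine Finset.sum_congr rfl fun j' _ => ?_
          by_cases h : i' = i ∧ j' = j
          · obtain ⟨rfl, rfl⟩ := h
            simp only [E, and_self, if_true]; omega
          · simp [E, h]
        have hIJ' := hA I J
        by_cases h : i ∈ I ∧ j ∈ J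
        · refine ⟨I, J, h.1, h.2, ?_⟩
          rw [if_pos h] at hsplit
          omega
        · rw [if_neg h] at hsplit
          omega
      -- If every edge at `i` is blocked by a tight pair, uncrossing yields one tight pair that
      -- contains `i` and all its neighbours. Dropping `i` from it lowers the demand by `k` but the
      -- block sum by the whole row, which exceeds `k`: a contradiction.
      obtain ⟨I, J, hiI, hJ, ht⟩ := exists_tight_of_row hA i htight
        (Finset.univ.filter fun j => 0 < A i j) (by simp)
      have he := blockSum_erase_le A hiI fun j hj => hJ (by simpa using hj)
      have hc := hA (I.erase i) J
      have hcard := Finset.card_erase_add_one hiI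
      rw [← hcard] at ht
      have : k * ((I.erase i).card + 1 + J.card) = k * ((I.erase i).card + J.card) + k := by ring
      omega

/-- The largest row or column sum. -/
def maxDeg (Z : SwitchMatrix n) : ℕ :=
  max (Finset.univ.sup fun i => ∑ j, Z i j) (Finset.univ.sup fun j => ∑ i, Z i j)

theorem maxDeg_le_iff {Z : SwitchMatrix n} {D : ℕ} :
    maxDeg Z ≤ D ↔ (∀ i, ∑ j, Z i j ≤ D) ∧ ∀ j, ∑ i, Z i j ≤ D := by
  simp [maxDeg, Finset.sup_le_iff]

theorem row_le_maxDeg (Z : SwitchMatrix n) (i : Fin n) : ∑ j, Z i j ≤ maxDeg Z :=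
  (maxDeg_le_iff.1 le_rfl).1 i

theorem col_le_maxDeg (Z : SwitchMatrix n) (j : Fin n) : ∑ i, Z i j ≤ maxDeg Z :=
  (maxDeg_le_iff.1 le_rfl).2 j

theorem maxDeg_add_le (Y Z : SwitchMatrix n) : maxDeg (Y + Z) ≤ maxDeg Y + maxDeg Z := by
  refine maxDeg_le_iff.2 ⟨fun i => ?_, fun j => ?_⟩ <;>
    simp only [Matrix.add_apply, Finset.sum_add_distrib]
  exacts [add_le_add (row_le_maxDeg Y i) (row_le_maxDeg Z i),
    add_le_add (col_le_maxDeg Y j) (col_le_maxDeg Z j)]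

theorem eq_zero_of_maxDeg_eq_zero {Z : SwitchMatrix n} (h : maxDeg Z = 0) : Z = 0 := by
  ext i j
  have := row_le_maxDeg Z i
  rw [h, Nat.le_zero, Finset.sum_eq_zero_iff] at this
  exact this j (Finset.mem_univ j)

/-- Rows and columns have the same total deficit, so a deficient row comes with a deficient column
and an edge can be added where they cross. -/
theorem exists_regular_ge {Z : SwitchMatrix n} {D : ℕ} (hr : ∀ i, ∑ j, Z i j ≤ D)
    (hc : ∀ j, ∑ i, Z i j ≤ D) :
    ∃ Y : SwitchMatrix n, (∀ i j, Z i j ≤ Y i j) ∧ RegularMatrix Y D := by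
  classical
  obtain ⟨N, hN⟩ : ∃ N, n * D - ∑ i, ∑ j, Z i j = N := ⟨_, rfl⟩
  induction N using Nat.strong_induction_on generalizing Z with
  | _ N ih =>
    by_cases h : ∃ i, ∑ j, Z i j < D
    · obtain ⟨i, hi⟩ := h
      have hlt : ∑ i, ∑ j, Z i j < n * D := by
        calc ∑ i, ∑ j, Z i j < ∑ _i : Fin n, D :=
              Finset.sum_lt_sum (fun i _ => hr i) ⟨i, Finset.mem_univ i, hi⟩
          _ = n * D := by simp
      obtain ⟨j, hj⟩ : ∃ j, ∑ i, Z i j < D := by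
        by_contra hcon
        push Not at hcon
        have : n * D ≤ ∑ j, ∑ i, Z i j := by
          calc n * D = ∑ _j : Fin n, D := by simp
            _ ≤ _ := Finset.sum_le_sum fun j _ => hcon j
        rw [Finset.sum_comm] at this
        omega
      let E : SwitchMatrix n := fun i' j' => if i' = i ∧ j' = j then 1 else 0
      have hE₁ : ∀ i', ∑ j', E i' j' = if i' = i then 1 else 0 := fun i' => by
        by_cases h : i' = i <;> simp [E, h]
      have hE₂ : ∀ j', ∑ i', E i' j' = if j' = j then 1 else 0 := fun j' => by
        by_cases h : j' = j <;> simp [E, h]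
      have htot : ∑ i', ∑ j', (Z i' j' + E i' j') = ∑ i', ∑ j', Z i' j' + 1 := by
        simp only [Finset.sum_add_distrib, hE₁]
        simp
      obtain ⟨Y, hY, hreg⟩ := ih (n * D - ∑ i', ∑ j', (Z i' j' + E i' j')) (by omega)
        (Z := fun i' j' => Z i' j' + E i' j')
        (fun i' => by
          rw [Finset.sum_add_distrib, hE₁]
          have := hr i'
          split_ifs with h
          · subst h; omega
          · omega)
        (fun j' => by
          rw [Finset.sum_add_distrib, hE₂]
          have := hc j'
          split_ifs with h
          · subst h; omega
          · omega) rfl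
      exact ⟨Y, fun i' j' => (Nat.le_add_right _ _).trans (hY i' j'), hreg⟩
    · push Not at h
      have hrow : ∀ i, ∑ j, Z i j = D := fun i => le_antisymm (hr i) (h i)
      refine ⟨Z, fun _ _ => le_rfl, hrow, fun j => ?_⟩
      have htot : ∑ j, ∑ i, Z i j = ∑ _j : Fin n, D := by
        rw [Finset.sum_comm]; simp [hrow]
      exact (Finset.sum_eq_sum_iff_of_le fun j _ => hc j).1 htot j (Finset.mem_univ j)

/-- Of the D|I| edges leaving I, at most D|Jᶜ| end outside J, so the block carries at least D(|I| -
|Jᶜ|). -/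
theorem RegularMatrix.factorCondition_one {Y : SwitchMatrix n} {D : ℕ} (hY : RegularMatrix Y D)
    (hD : 0 < D) : FactorCondition Y 1 := by
  classical
  intro I J
  have h₁ : ∑ i ∈ I, ∑ j, Y i j = I.card * D := by simp [hY.1]
  have h₂ : ∑ j ∈ Jᶜ, ∑ i, Y i j = Jᶜ.card * D := by simp [hY.2]
  have h₃ : ∑ i ∈ I, ∑ j, Y i j = blockSum Y I J + ∑ i ∈ I, ∑ j ∈ Jᶜ, Y i j := by
    rw [blockSum, ← Finset.sum_add_distrib]
    exact Finset.sum_congr rfl fun i _ => (Finset.sum_add_sum_compl J _).symm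
  have h₄ : ∑ i ∈ I, ∑ j ∈ Jᶜ, Y i j ≤ Jᶜ.card * D := by
    rw [← h₂]
    refine Finset.sum_comm.trans_le (Finset.sum_le_sum fun j _ => ?_)
    exact Finset.sum_le_univ_sum_of_nonneg fun _ => Nat.zero_le _
  have h₅ : J.card + Jᶜ.card = n := by simp [Finset.card_add_card_compl]
  rw [h₁] at h₃
  rcases le_total I.card Jᶜ.card with h | h
  · omega
  · obtain ⟨e, he⟩ := Nat.exists_eq_add_of_le h
    have : e ≤ e * D := Nat.le_mul_of_pos_right e hD
    rw [he, add_mul] at h₃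
    omega

/-- Every array of queue sizes has a matching that meets all rows and columns of maximal sum. -/
theorem exists_critical_matching (Z : SwitchMatrix n) :
    ∃ σ ∈ feasibleSchedules n, (∀ i j, σ i j ≤ Z i j) ∧ maxDeg (Z - σ) ≤ maxDeg Z - 1 := by
  classical
  rcases Nat.eq_zero_or_pos (maxDeg Z) with h0 | hpos
  · refine ⟨0, by simp [feasibleSchedules], by simp, ?_⟩
    rw [eq_zero_of_maxDeg_eq_zero h0]
    simp [maxDeg]
  -- Pad `Z` to a regular multigraph, take a perfect matching of it and keep only the edges that
  -- belong to `Z`.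
  obtain ⟨Y, hZY, hY⟩ := exists_regular_ge (row_le_maxDeg Z) (col_le_maxDeg Z)
  obtain ⟨τ, hτY, hτ⟩ := (hY.factorCondition_one hpos).exists_factor
  have key : ∀ z y t : Fin n → ℕ, (∀ j, z j ≤ y j) → (∀ j, t j ≤ y j) → ∑ j, t j = 1 →
      ∑ j, y j = maxDeg Z → ∑ j, (z j - min (t j) (z j)) ≤ maxDeg Z - 1 := by
    intro z y t hzy hty ht hy
    -- The left side is the maximum of `z j` and `t j`.
    have h₁ : ∀ j, z j - min (t j) (z j) + t j ≤ y j := fun j => by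
      have := hzy j; have := hty j; omega
    have h₂ := Finset.sum_le_sum fun j (_ : j ∈ Finset.univ) => h₁ j
    rw [Finset.sum_add_distrib] at h₂
    omega
  have hle : ∀ i j, τ i j ≤ 1 := fun i j => by
    rw [← hτ.1 i]
    exact Finset.single_le_sum (f := fun j => τ i j) (fun _ _ => Nat.zero_le _) (Finset.mem_univ j)
  refine ⟨fun i j => min (τ i j) (Z i j), ⟨fun i j => ?_, fun i => ?_, fun j => ?_⟩,
    fun i j => min_le_right _ _, maxDeg_le_iff.2 ⟨fun i => ?_, fun j => ?_⟩⟩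
  · have := hle i j
    rcases Nat.le_one_iff_eq_zero_or_eq_one.1 ((min_le_left (τ i j) (Z i j)).trans this) with h | h
    exacts [Or.inl h, Or.inr h]
  · rw [← hτ.1 i]; exact Finset.sum_le_sum fun j _ => min_le_left _ _
  · rw [← hτ.2 j]; exact Finset.sum_le_sum fun i _ => min_le_left _ _
  · exact key (fun j => Z i j) (fun j => Y i j) (fun j => τ i j) (hZY i) (hτY i) (hτ.1 i) (hY.1 i)
  · exact key (fun i => Z i j) (fun i => Y i j) (fun i => τ i j) (fun i => hZY i j)
      (fun i => hτY i j) (hτ.2 j) (hY.2 j)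

/-- A matching that meets all rows and columns of maximal sum. -/
noncomputable def criticalMatching (Z : SwitchMatrix n) : SwitchMatrix n :=
  (exists_critical_matching Z).choose

theorem criticalMatching_feasible (Z : SwitchMatrix n) :
    criticalMatching Z ∈ feasibleSchedules n := (exists_critical_matching Z).choose_spec.1

theorem criticalMatching_le (Z : SwitchMatrix n) (i j : Fin n) :
    criticalMatching Z i j ≤ Z i j := (exists_critical_matching Z).choose_spec.2.1 i j

theorem maxDeg_sub_criticalMatching (Z : SwitchMatrix n) :
    maxDeg (Z - criticalMatching Z) ≤ maxDeg Z - 1 := (exists_critical_matching Z).choose_spec.2.2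

/-- What is left of `Z` after `l` successive critical matchings have been removed. -/
noncomputable def leftover (Z : SwitchMatrix n) : ℕ → SwitchMatrix n
  | 0 => Z
  | l + 1 => leftover Z l - criticalMatching (leftover Z l)

theorem leftover_succ_add (Z : SwitchMatrix n) (l : ℕ) :
    leftover Z (l + 1) + criticalMatching (leftover Z l) = leftover Z l := by
  ext i j
  exact Nat.sub_add_cancel (criticalMatching_le _ i j)

theorem maxDeg_leftover_le (Z : SwitchMatrix n) (l : ℕ) :
    maxDeg (leftover Z l) ≤ maxDeg Z - l := by
  induction l with
  | zero => exact le_rfl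
  | succ l ih =>
    have := maxDeg_sub_criticalMatching (leftover Z l)
    simp only [leftover]
    omega

/-- The total number of packets. -/
def total (Z : SwitchMatrix n) : ℕ := ∑ i, ∑ j, Z i j

theorem total_add (Y Z : SwitchMatrix n) : total (Y + Z) = total Y + total Z := by
  simp [total, Finset.sum_add_distrib]

theorem total_mono {Y Z : SwitchMatrix n} (h : ∀ i j, Y i j ≤ Z i j) : total Y ≤ total Z :=
  Finset.sum_le_sum fun i _ => Finset.sum_le_sum fun j _ => h i j

theorem total_le_mul_maxDeg (Z : SwitchMatrix n) : total Z ≤ n * maxDeg Z := by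
  calc total Z ≤ ∑ _i : Fin n, maxDeg Z := Finset.sum_le_sum fun i _ => row_le_maxDeg Z i
    _ = n * maxDeg Z := by simp

theorem total_le_of_feasible {σ : SwitchMatrix n} (h : σ ∈ feasibleSchedules n) : total σ ≤ n := by
  calc total σ ≤ ∑ _i : Fin n, 1 := Finset.sum_le_sum fun i _ => h.2.1 i
    _ = n := by simp

theorem RegularMatrix.maxDeg_le {G : SwitchMatrix n} {k : ℕ} (hG : RegularMatrix G k) : maxDeg G ≤ k :=
  maxDeg_le_iff.2 ⟨fun i => (hG.1 i).le, fun j => (hG.2 j).le⟩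

theorem RegularMatrix.leftover_self {G : SwitchMatrix n} {k : ℕ} (hG : RegularMatrix G k) :
    leftover G k = 0 := by
  apply eq_zero_of_maxDeg_eq_zero
  have := maxDeg_leftover_le G k
  have := hG.maxDeg_le
  omega

theorem total_add_le_total_leftover {Z : SwitchMatrix n} (l : ℕ) :
    total Z ≤ total (leftover Z l) + n * l := by
  induction l with
  | zero => simp [leftover]
  | succ l ih =>
    have h₁ := congrArg total (leftover_succ_add Z l)
    rw [total_add] at h₁
    have h₂ := total_le_of_feasible (criticalMatching_feasible (leftover Z l))
    rw [mul_add]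
    omega

/-- The degree bound gives one inequality; the other holds because a matching removes at most `n`
packets. Equality forces every removed matching to be perfect. -/
theorem RegularMatrix.total_leftover {G : SwitchMatrix n} {k l : ℕ} (hG : RegularMatrix G k) (hl : l ≤ k) :
    total (leftover G l) + n * l = n * k := by
  have ht : total G = n * k := by simp [total, hG.1]
  apply le_antisymm
  · have h₁ := total_le_mul_maxDeg (leftover G l)
    have h₂ := maxDeg_leftover_le G l
    have h₃ := hG.maxDeg_le
    have h₄ : n * maxDeg (leftover G l) ≤ n * (k - l) := Nat.mul_le_mul_left n (by omega)
    have h₅ : n * (k - l) + n * l = n * k := by rw [← mul_add, Nat.sub_add_cancel hl]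
    omega
  · rw [← ht]
    exact total_add_le_total_leftover l

/-- The matchings into which a `k`-factor splits have exactly `n` edges. -/
theorem RegularMatrix.total_criticalMatching {G : SwitchMatrix n} {k l : ℕ} (hG : RegularMatrix G k)
    (hl : l < k) : total (criticalMatching (leftover G l)) = n := by
  have h₁ := congrArg total (leftover_succ_add G l)
  rw [total_add] at h₁
  have h₂ := hG.total_leftover (l := l) hl.le
  have h₃ := hG.total_leftover (l := l + 1) hl
  rw [mul_add] at h₃
  omega

open Classical in
/-- A `k`-factor of `A` if there is one, and `0` otherwise. -/
noncomputable def factor (k : ℕ) (A : SwitchMatrix n) : SwitchMatrix n :=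
  if h : FactorCondition A k then h.exists_factor.choose else 0

theorem factor_le (k : ℕ) (A : SwitchMatrix n) (i j : Fin n) : factor k A i j ≤ A i j := by
  unfold factor
  split_ifs with h
  · exact h.exists_factor.choose_spec.1 i j
  · exact Nat.zero_le _

theorem FactorCondition.regularMatrix_factor {A : SwitchMatrix n} {k : ℕ} (h : FactorCondition A k) :
    RegularMatrix (factor k A) k := by
  rw [factor, dif_pos h]
  exact h.exists_factor.choose_spec.2

theorem maxDeg_zero : maxDeg (0 : SwitchMatrix n) = 0 := by simp [maxDeg]

/-- The default `0` makes this unconditional, so the packet accounting needs no assumption that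
factors exist. -/
theorem leftover_factor (k : ℕ) (A : SwitchMatrix n) : leftover (factor k A) k = 0 := by
  by_cases h : FactorCondition A k
  · exact h.regularMatrix_factor.leftover_self
  · apply eq_zero_of_maxDeg_eq_zero
    have h₁ := maxDeg_leftover_le (factor k A) k
    have h₂ : factor k A = 0 := dif_neg h
    rw [h₂, maxDeg_zero] at h₁
    rw [h₂]; omega

end Combinatorics

/-! ### Recovering the arrivals from the observed queue sizes. -/

section Realization

variable {n : ℕ}

/-- The arrivals that are consistent with the given queue sizes (most recent first) when the
schedules are the values of `F`. -/
def reconstructArrivals (F : ℕ → (ℕ → SwitchMatrix n) → SwitchMatrix n) :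
    List (SwitchMatrix n) → ℕ → SwitchMatrix n
  | [] => 0
  | [_] => 0
  | q :: q' :: l =>
    Function.update (reconstructArrivals F (q' :: l)) l.length
      (q - (q' - F l.length (reconstructArrivals F (q' :: l))))

theorem SchedulingPolicy.length_past (π : SchedulingPolicy n) (x : ℕ → SwitchMatrix n) (t : ℕ) :
    (π.past x t).length = t := by
  induction t with
  | zero => rfl
  | succ t ih => rw [π.past_succ, List.length_cons, ih]

/-- Every rule that chooses schedules on the basis of the past arrivals is realized by a
scheduling policy. -/
theorem exists_policy_of_causal (F : ℕ → (ℕ → SwitchMatrix n) → SwitchMatrix n)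
    (hF : ∀ t x y, (∀ s < t, x s = y s) → F t x = F t y)
    (hfeas : ∀ t x, F t x ∈ feasibleSchedules n) :
    ∃ π : SchedulingPolicy n, ∀ x t, π.schedule (π.queue x t) (π.past x t) = F t x := by
  let π : SchedulingPolicy n :=
    { schedule := fun q l => F l.length (reconstructArrivals F (q :: l))
      feasible := fun q l => hfeas _ _ }
  refine ⟨π, fun x t => ?_⟩
  -- Only slots before `t` are recovered; by causality the default `0` elsewhere does not affect the
  -- schedule.
  have key : ∀ t, ∀ s < t, reconstructArrivals F (π.queue x t :: π.past x t) s = x s := by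
    intro t
    induction t with
    | zero => intro s hs; omega
    | succ t ih =>
      intro s hs
      rw [π.past_succ, reconstructArrivals, π.length_past]
      rcases Nat.lt_succ_iff_lt_or_eq.1 hs with h | rfl
      · rw [Function.update_of_ne h.ne, ih s h]
      · rw [Function.update_self]
        ext i j
        have h₁ : π.schedule (π.queue x s) (π.past x s) =
            F s (reconstructArrivals F (π.queue x s :: π.past x s)) := by
          change F (π.past x s).length _ = _
          rw [π.length_past]
        rw [← h₁, Matrix.sub_apply, Matrix.sub_apply, π.queue_succ]
        omega
  change F (π.past x t).length _ = _
  rw [π.length_past]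
  exact hF _ _ _ (key t)

end Realization

/-! ### The batching policy and its pathwise packet accounting. -/

section Batching

variable {n : ℕ}

/-- The arrivals in the slots `s, …, t - 1`. -/
def arrivalsIn (x : ℕ → SwitchMatrix n) (s t : ℕ) : SwitchMatrix n := ∑ u ∈ Finset.Ico s t, x u

theorem arrivalsIn_congr {x y : ℕ → SwitchMatrix n} {s t : ℕ} (h : ∀ u < t, x u = y u) :
    arrivalsIn x s t = arrivalsIn y s t :=
  Finset.sum_congr rfl fun u hu => h u (Finset.mem_Ico.1 hu).2

theorem arrivalsIn_add (x : ℕ → SwitchMatrix n) {s t u : ℕ} (h₁ : s ≤ t) (h₂ : t ≤ u) :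
    arrivalsIn x s t + arrivalsIn x t u = arrivalsIn x s u :=
  Finset.sum_Ico_consecutive _ h₁ h₂

theorem arrivalsIn_mono (x : ℕ → SwitchMatrix n) {s t u : ℕ} (h₁ : s ≤ t) (h₂ : t ≤ u)
    (i j : Fin n) : arrivalsIn x s t i j ≤ arrivalsIn x s u i j := by
  rw [← arrivalsIn_add x h₁ h₂]
  exact Nat.le_add_right _ _

variable (d M k : ℕ) (x : ℕ → SwitchMatrix n)

/-- The arrivals in interval `m` of batch `r`; batches consist of `M` intervals of `d` slots. -/
def intervalArrivals (r m : ℕ) : SwitchMatrix n :=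
  arrivalsIn x (r * (M * d) + m * d) (r * (M * d) + (m + 1) * d)

/-- The packets of batch `r` outside of the `k`-factors of its first `m` intervals. -/
noncomputable def unfactored (r m : ℕ) : SwitchMatrix n :=
  ∑ m' ∈ Finset.range m,
    (intervalArrivals d M x r m' - factor k (intervalArrivals d M x r m'))

/-- The packets of the batches before batch `r` that are left over when the service of
batch `r` starts. -/
noncomputable def backlog : ℕ → SwitchMatrix n
  | 0 => 0
  | r + 1 => leftover (backlog r + unfactored d M k x r M) (M * d - M * k)

/-- The schedule in slot `u` after the start of the service. -/
noncomputable def serviceSchedule (u : ℕ) : SwitchMatrix n :=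
  let r := u / (M * d)
  let q := u % (M * d)
  if q < M * k then
    criticalMatching (leftover (factor k (intervalArrivals d M x r (q / k))) (q % k))
  else
    criticalMatching (leftover (backlog d M k x r + unfactored d M k x r M) (q - M * k))

/-- The slot in which the service starts. -/
def startSlot : ℕ := d + M * (d - k)

/-- The schedule of the batching policy. -/
noncomputable def batchSchedule (t : ℕ) : SwitchMatrix n :=
  if t < startSlot d M k then 0 else serviceSchedule d M k x (t - startSlot d M k)

variable {d M k x}

theorem intervalArrivals_congr {y : ℕ → SwitchMatrix n} {r m : ℕ}
    (h : ∀ s < r * (M * d) + (m + 1) * d, x s = y s) :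
    intervalArrivals d M x r m = intervalArrivals d M y r m := arrivalsIn_congr h

theorem unfactored_congr {y : ℕ → SwitchMatrix n} {r m : ℕ}
    (h : ∀ s < r * (M * d) + m * d, x s = y s) :
    unfactored d M k x r m = unfactored d M k y r m := by
  refine Finset.sum_congr rfl fun m' hm' => ?_
  rw [intervalArrivals_congr fun s hs => h s (hs.trans_le ?_)]
  have : m' + 1 ≤ m := Finset.mem_range.1 hm'
  gcongr

theorem backlog_congr {y : ℕ → SwitchMatrix n} {r : ℕ} (h : ∀ s < r * (M * d), x s = y s) :
    backlog d M k x r = backlog d M k y r := by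
  induction r with
  | zero => rfl
  | succ r ih =>
    rw [add_mul, one_mul] at h
    rw [backlog, backlog, ih fun s hs => h s (by omega), unfactored_congr h]

/-- The reason for the value of `startSlot`: interval `m` ends after (m + 1)d slots and its service
begins mk slots into the batch's service, a gap of d + m(d - k). -/
theorem interval_ready (hkd : k ≤ d) {r m l : ℕ} (hm : m < M) :
    r * (M * d) + (m + 1) * d ≤ r * (M * d) + (m * k + l) + startSlot d M k := by
  obtain ⟨e, rfl⟩ := Nat.exists_eq_add_of_le hkd
  have h : m * e ≤ M * e := Nat.mul_le_mul_right e hm.le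
  simp only [startSlot, Nat.add_sub_cancel_left]
  nlinarith

/-- Clearing begins after Mk slots of service and needs all Md slots of arrivals, a gap of M(d - k).
-/
theorem batch_ready (hkd : k ≤ d) {r l : ℕ} :
    r * (M * d) + M * d ≤ r * (M * d) + (M * k + l) + startSlot d M k := by
  obtain ⟨e, rfl⟩ := Nat.exists_eq_add_of_le hkd
  simp only [startSlot, Nat.add_sub_cancel_left]
  nlinarith

theorem serviceSchedule_congr {y : ℕ → SwitchMatrix n} (hkd : k ≤ d) {u : ℕ}
    (h : ∀ s < u + startSlot d M k, x s = y s) :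
    serviceSchedule d M k x u = serviceSchedule d M k y u := by
  have hu : u / (M * d) * (M * d) + u % (M * d) = u := Nat.div_add_mod' u (M * d)
  have hb : backlog d M k x (u / (M * d)) = backlog d M k y (u / (M * d)) :=
    backlog_congr fun s hs => h s (by omega)
  simp only [serviceSchedule]
  split_ifs with hq
  · have hk : 0 < k := by
      rcases Nat.eq_zero_or_pos k with rfl | hk
      · simp at hq
      · exact hk
    have hm : u % (M * d) / k < M := (Nat.div_lt_iff_lt_mul hk).2 hq
    have hr := interval_ready hkd (r := u / (M * d)) (l := u % (M * d) % k) hm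
    rw [Nat.div_add_mod' (u % (M * d)) k, hu] at hr
    rw [intervalArrivals_congr fun s hs => h s (hs.trans_le hr)]
  · obtain ⟨l, hl⟩ := Nat.exists_eq_add_of_le (not_lt.1 hq)
    have hr := batch_ready (M := M) hkd (r := u / (M * d)) (l := l)
    rw [← hl, hu] at hr
    rw [hb, unfactored_congr fun s hs => h s (hs.trans_le hr)]

theorem batchSchedule_congr {y : ℕ → SwitchMatrix n} (hkd : k ≤ d) {t : ℕ}
    (h : ∀ s < t, x s = y s) : batchSchedule d M k x t = batchSchedule d M k y t := by
  unfold batchSchedule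
  split_ifs with ht
  · rfl
  · exact serviceSchedule_congr hkd (by rwa [Nat.sub_add_cancel (not_lt.1 ht)])

theorem batchSchedule_feasible (t : ℕ) : batchSchedule d M k x t ∈ feasibleSchedules n := by
  simp only [batchSchedule, serviceSchedule]
  split_ifs
  · simp [feasibleSchedules]
  · exact criticalMatching_feasible _
  · exact criticalMatching_feasible _

theorem serviceSchedule_factor (hkd : k ≤ d) {r m l : ℕ} (hm : m < M) (hl : l < k) :
    serviceSchedule d M k x (r * (M * d) + (m * k + l)) =
      criticalMatching (leftover (factor k (intervalArrivals d M x r m)) l) := by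
  have h₁ : m * k + l < M * k := by
    calc m * k + l < m * k + k := by omega
      _ = (m + 1) * k := by ring
      _ ≤ M * k := Nat.mul_le_mul_right k hm
  have h₂ : m * k + l < M * d := h₁.trans_le (Nat.mul_le_mul_left M hkd)
  have h₃ : (r * (M * d) + (m * k + l)) / (M * d) = r := by
    rw [add_comm, Nat.add_mul_div_right _ _ (by omega), Nat.div_eq_of_lt h₂, zero_add]
  have h₄ : (r * (M * d) + (m * k + l)) % (M * d) = m * k + l := by
    rw [add_comm, Nat.add_mul_mod_self_right, Nat.mod_eq_of_lt h₂]
  have h₅ : (m * k + l) / k = m := by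
    rw [add_comm, Nat.add_mul_div_right _ _ (by omega), Nat.div_eq_of_lt hl, zero_add]
  have h₆ : (m * k + l) % k = l := by
    rw [add_comm, Nat.add_mul_mod_self_right, Nat.mod_eq_of_lt hl]
  simp only [serviceSchedule, h₃, h₄, h₅, h₆, if_pos h₁]

theorem serviceSchedule_clear {r l : ℕ} (hl : M * k + l < M * d) :
    serviceSchedule d M k x (r * (M * d) + (M * k + l)) =
      criticalMatching (leftover (backlog d M k x r + unfactored d M k x r M) l) := by
  have h₃ : (r * (M * d) + (M * k + l)) / (M * d) = r := by
    rw [add_comm, Nat.add_mul_div_right _ _ (by omega), Nat.div_eq_of_lt hl, zero_add]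
  have h₄ : (r * (M * d) + (M * k + l)) % (M * d) = M * k + l := by
    rw [add_comm, Nat.add_mul_mod_self_right, Nat.mod_eq_of_lt hl]
  have h₁ : ¬ M * k + l < M * k := by omega
  simp only [serviceSchedule, h₃, h₄, if_neg h₁, Nat.add_sub_cancel_left]

variable (d M k x) in
/-- The services scheduled in the first `u` slots after the start of the service. -/
noncomputable def served (u : ℕ) : SwitchMatrix n :=
  ∑ v ∈ Finset.range u, serviceSchedule d M k x v

theorem served_succ (u : ℕ) :
    served d M k x (u + 1) = served d M k x u + serviceSchedule d M k x u :=
  Finset.sum_range_succ _ _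

/-- Conservation of packets while the factor of interval `m` is served: each slot moves one matching
from the leftover to the served packets. -/
theorem served_factor_aux (hkd : k ≤ d) {r m : ℕ} (hm : m < M)
    (h : served d M k x (r * (M * d) + m * k) + backlog d M k x r + unfactored d M k x r m =
      arrivalsIn x 0 (r * (M * d) + m * d)) {l : ℕ} (hl : l ≤ k) :
    served d M k x (r * (M * d) + (m * k + l)) + backlog d M k x r + unfactored d M k x r m +
        leftover (factor k (intervalArrivals d M x r m)) l =
      arrivalsIn x 0 (r * (M * d) + m * d) + factor k (intervalArrivals d M x r m) := by
  induction l with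
  | zero => rw [add_zero, h]; rfl
  | succ l ih =>
    rw [← ih (by omega), ← leftover_succ_add _ l, ← add_assoc, ← add_assoc, served_succ,
      add_assoc _ _ l, serviceSchedule_factor hkd hm hl]
    abel

theorem served_factor (hkd : k ≤ d) {r : ℕ}
    (h : served d M k x (r * (M * d)) + backlog d M k x r = arrivalsIn x 0 (r * (M * d)))
    {m : ℕ} (hm : m ≤ M) :
    served d M k x (r * (M * d) + m * k) + backlog d M k x r + unfactored d M k x r m =
      arrivalsIn x 0 (r * (M * d) + m * d) := by
  induction m with
  | zero => simpa [unfactored] using h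
  | succ m ih =>
    have h₁ := served_factor_aux hkd hm (ih (by omega)) le_rfl
    rw [leftover_factor, add_zero] at h₁
    have h₂ : intervalArrivals d M x r m - factor k (intervalArrivals d M x r m) +
        factor k (intervalArrivals d M x r m) = intervalArrivals d M x r m := by
      ext i j
      exact Nat.sub_add_cancel (factor_le _ _ i j)
    have h₃ : arrivalsIn x 0 (r * (M * d) + m * d) + intervalArrivals d M x r m =
        arrivalsIn x 0 (r * (M * d) + (m + 1) * d) :=
      arrivalsIn_add x (Nat.zero_le _) (by gcongr; omega)
    have h₄ : unfactored d M k x r (m + 1) = unfactored d M k x r m +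
        (intervalArrivals d M x r m - factor k (intervalArrivals d M x r m)) :=
      Finset.sum_range_succ _ _
    rw [← h₃, h₄, ← add_assoc, add_mul, one_mul, h₁, add_assoc, add_comm (factor _ _), h₂]

theorem served_clear (hkd : k ≤ d) {r : ℕ}
    (h : served d M k x (r * (M * d)) + backlog d M k x r = arrivalsIn x 0 (r * (M * d)))
    {l : ℕ} (hl : M * k + l ≤ M * d) :
    served d M k x (r * (M * d) + (M * k + l)) +
        leftover (backlog d M k x r + unfactored d M k x r M) l =
      arrivalsIn x 0 (r * (M * d) + M * d) := by
  induction l with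
  | zero => rw [← served_factor hkd h le_rfl, add_zero, add_assoc]; rfl
  | succ l ih =>
    rw [← ih (by omega), ← leftover_succ_add _ l, ← add_assoc, ← add_assoc, served_succ,
      add_assoc _ _ l, serviceSchedule_clear (by omega)]
    abel

theorem served_add_backlog (hkd : k ≤ d) (r : ℕ) :
    served d M k x (r * (M * d)) + backlog d M k x r = arrivalsIn x 0 (r * (M * d)) := by
  induction r with
  | zero => simp [served, backlog, arrivalsIn]
  | succ r ih =>
    have h : M * k ≤ M * d := Nat.mul_le_mul_left M hkd
    have := served_clear hkd ih (l := M * d - M * k) (by omega)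
    rw [Nat.add_sub_cancel' h] at this
    rw [add_mul, one_mul, ← this]
    rfl

/-- No service is scheduled for a packet that has not arrived. -/
theorem served_succ_le (hkd : k ≤ d) (hb : 0 < M * d) (u : ℕ) (i j : Fin n) :
    served d M k x (u + 1) i j ≤ arrivalsIn x 0 (u + startSlot d M k) i j := by
  obtain ⟨r, q, hq, rfl⟩ : ∃ r q, q < M * d ∧ u = r * (M * d) + q :=
    ⟨u / (M * d), u % (M * d), Nat.mod_lt _ hb, (Nat.div_add_mod' u (M * d)).symm⟩
  have h := served_add_backlog (x := x) (M := M) hkd r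
  by_cases hqk : q < M * k
  · have hk : 0 < k := by
      rcases Nat.eq_zero_or_pos k with rfl | hk
      · simp at hqk
      · exact hk
    obtain ⟨m, l, hl, rfl⟩ : ∃ m l, l < k ∧ q = m * k + l :=
      ⟨q / k, q % k, Nat.mod_lt _ hk, (Nat.div_add_mod' q k).symm⟩
    have hm : m < M := by
      by_contra hm
      have := Nat.mul_le_mul_right k (not_lt.1 hm)
      omega
    -- After this slot the services are still bounded by the arrivals up to the end of interval `m`,
    -- which precede the slot by `interval_ready`.
    have h₁ := served_factor_aux hkd hm (served_factor hkd h hm.le) (Nat.succ_le_of_lt hl)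
    have h₂ := congrFun (congrFun h₁ i) j
    have h₃ := factor_le k (intervalArrivals d M x r m) i j
    have h₄ := congrFun (congrFun (arrivalsIn_add x (Nat.zero_le (r * (M * d) + m * d))
      (u := r * (M * d) + (m + 1) * d) (by gcongr; omega)) i) j
    have h₅ := arrivalsIn_mono x (Nat.zero_le _) (interval_ready hkd (r := r) (l := l) hm) i j
    simp only [Matrix.add_apply] at h₂ h₄
    rw [add_assoc _ _ 1, add_assoc _ _ 1]
    simp only [intervalArrivals, Nat.succ_eq_add_one] at h₂ h₃
    omega
  · obtain ⟨l, rfl⟩ := Nat.exists_eq_add_of_le (not_lt.1 hqk)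
    have h₁ := served_clear hkd h (l := l + 1) (by omega)
    have h₂ := congrFun (congrFun h₁ i) j
    have h₅ := arrivalsIn_mono x (Nat.zero_le _) (batch_ready (M := M) hkd (r := r) (l := l)) i j
    simp only [Matrix.add_apply] at h₂
    rw [add_assoc _ _ 1, add_assoc _ _ 1]
    omega

theorem sum_batchSchedule_of_le {t : ℕ} (ht : t ≤ startSlot d M k) :
    ∑ s ∈ Finset.range t, batchSchedule d M k x s = 0 := by
  refine Finset.sum_eq_zero fun s hs => if_pos ?_
  have := Finset.mem_range.1 hs
  omega

theorem sum_batchSchedule (u : ℕ) :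
    ∑ s ∈ Finset.range (u + startSlot d M k), batchSchedule d M k x s = served d M k x u := by
  rw [add_comm, Finset.sum_range_add, sum_batchSchedule_of_le le_rfl, zero_add]
  refine Finset.sum_congr rfl fun v _ => ?_
  rw [batchSchedule, if_neg (by omega), Nat.add_sub_cancel_left]

theorem sum_batchSchedule_succ_le (hkd : k ≤ d) (hb : 0 < M * d) (t : ℕ) (i j : Fin n) :
    (∑ s ∈ Finset.range (t + 1), batchSchedule d M k x s) i j ≤ arrivalsIn x 0 t i j := by
  rcases Nat.lt_or_ge t (startSlot d M k) with ht | ht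
  · rw [sum_batchSchedule_of_le ht]; exact Nat.zero_le _
  · obtain ⟨u, rfl⟩ := Nat.exists_eq_add_of_le' ht
    rw [add_right_comm, sum_batchSchedule]
    exact served_succ_le hkd hb u i j

/-- Under the batching policy all scheduled services take place. -/
theorem queue_add_sum_batchSchedule (hkd : k ≤ d) (hb : 0 < M * d) {π : SchedulingPolicy n}
    (hπ : ∀ t, π.schedule (π.queue x t) (π.past x t) = batchSchedule d M k x t) (t : ℕ) :
    π.queue x t + ∑ s ∈ Finset.range t, batchSchedule d M k x s = arrivalsIn x 0 t := by
  induction t with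
  | zero => simp [arrivalsIn, π.queue_zero]
  | succ t ih =>
    ext i j
    have h₁ := sum_batchSchedule_succ_le (x := x) hkd hb t i j
    have h₂ := congrFun (congrFun ih i) j
    have h₃ := congrFun (congrFun (arrivalsIn_add x (Nat.zero_le t) (Nat.le_succ t)) i) j
    have h₄ : arrivalsIn x t (t + 1) = x t := by simp [arrivalsIn]
    rw [Finset.sum_range_succ] at h₁ ⊢
    simp only [Nat.succ_eq_add_one] at h₃
    rw [h₄] at h₃
    simp only [Matrix.add_apply] at h₁ h₂ h₃ ⊢
    rw [π.queue_succ, hπ]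
    omega

theorem total_serviceSchedule {r : ℕ} (hkd : k ≤ d)
    (hgood : ∀ m < M, FactorCondition (intervalArrivals d M x r m) k) {q : ℕ} (hq : q < M * k) :
    total (serviceSchedule d M k x (r * (M * d) + q)) = n := by
  have hk : 0 < k := by
    rcases Nat.eq_zero_or_pos k with rfl | hk
    · simp at hq
    · exact hk
  obtain ⟨m, l, hl, rfl⟩ : ∃ m l, l < k ∧ q = m * k + l :=
    ⟨q / k, q % k, Nat.mod_lt _ hk, (Nat.div_add_mod' q k).symm⟩
  have hm : m < M := by
    by_contra hm
    have := Nat.mul_le_mul_right k (not_lt.1 hm)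
    omega
  rw [serviceSchedule_factor hkd hm hl]
  exact (hgood m hm).regularMatrix_factor.total_criticalMatching hl

theorem total_served_ge (r q : ℕ) :
    total (served d M k x (r * (M * d))) ≤ total (served d M k x (r * (M * d) + q)) := by
  refine total_mono fun i j => ?_
  simp only [served, Matrix.sum_apply]
  exact Finset.sum_le_sum_of_subset (Finset.range_mono (Nat.le_add_right _ _))

theorem total_served_of_good {r : ℕ} (hkd : k ≤ d)
    (hgood : ∀ m < M, FactorCondition (intervalArrivals d M x r m) k) (q : ℕ) :
    total (served d M k x (r * (M * d))) + n * min q (M * k) ≤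
      total (served d M k x (r * (M * d) + q)) := by
  induction q with
  | zero => simp
  | succ q ih =>
    rw [← add_assoc, served_succ, total_add]
    rcases Nat.lt_or_ge q (M * k) with h | h
    · rw [total_serviceSchedule hkd hgood h]
      rw [min_eq_left h.le] at ih
      rw [min_eq_left (by omega), mul_add]
      omega
    · rw [min_eq_right h] at ih
      rw [min_eq_right (by omega)]
      omega

/-! ### Queue sizes measured from the start of a batch. -/

section Queue

variable {π : SchedulingPolicy n}

/-- Services before batch `r` account for all earlier arrivals except the backlog, so the queue
depends on the distant past only through it. -/
theorem total_queue_add_served (hkd : k ≤ d) (hb : 0 < M * d)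
    (hπ : ∀ t, π.schedule (π.queue x t) (π.past x t) = batchSchedule d M k x t) (r q : ℕ) :
    total (π.queue x (r * (M * d) + q + startSlot d M k)) +
        total (served d M k x (r * (M * d) + q)) =
      total (served d M k x (r * (M * d))) + total (backlog d M k x r) +
        total (arrivalsIn x (r * (M * d)) (r * (M * d) + q + startSlot d M k)) := by
  have h₁ := queue_add_sum_batchSchedule hkd hb hπ (r * (M * d) + q + startSlot d M k)
  rw [sum_batchSchedule] at h₁
  have h₂ := served_add_backlog (x := x) (M := M) hkd r
  have h₃ := arrivalsIn_add x (Nat.zero_le (r * (M * d)))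
    (show r * (M * d) ≤ r * (M * d) + q + startSlot d M k by omega)
  rw [← total_add, ← total_add, ← total_add, h₁, h₂, h₃]

theorem total_queue_le (hkd : k ≤ d) (hb : 0 < M * d)
    (hπ : ∀ t, π.schedule (π.queue x t) (π.past x t) = batchSchedule d M k x t) (r q : ℕ) :
    total (π.queue x (r * (M * d) + q + startSlot d M k)) ≤ total (backlog d M k x r) +
        total (arrivalsIn x (r * (M * d)) (r * (M * d) + q + startSlot d M k)) := by
  have h₁ := total_queue_add_served hkd hb hπ r q
  have h₂ := total_served_ge (d := d) (M := M) (k := k) (x := x) r q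
  omega

theorem total_queue_le_of_good (hkd : k ≤ d) (hb : 0 < M * d)
    (hπ : ∀ t, π.schedule (π.queue x t) (π.past x t) = batchSchedule d M k x t) {r : ℕ}
    (hgood : ∀ m < M, FactorCondition (intervalArrivals d M x r m) k) (q : ℕ) :
    total (π.queue x (r * (M * d) + q + startSlot d M k)) + n * min q (M * k) ≤
      total (backlog d M k x r) +
        total (arrivalsIn x (r * (M * d)) (r * (M * d) + q + startSlot d M k)) := by
  have h₁ := total_queue_add_served hkd hb hπ r q
  have h₂ := total_served_of_good hkd hgood q
  omega

theorem queue_le_arrivals (π : SchedulingPolicy n) (t : ℕ) (i j : Fin n) :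
    π.queue x t i j ≤ arrivalsIn x 0 t i j := by
  induction t with
  | zero => exact Nat.zero_le _
  | succ t ih =>
    have h₃ := congrFun (congrFun (arrivalsIn_add x (Nat.zero_le t) (Nat.le_succ t)) i) j
    have h₄ : arrivalsIn x t (t + 1) = x t := by simp [arrivalsIn]
    simp only [Nat.succ_eq_add_one, Matrix.add_apply] at h₃
    rw [h₄] at h₃
    rw [π.queue_succ]
    omega

end Queue

theorem maxDeg_mono {Y Z : SwitchMatrix n} (h : ∀ i j, Y i j ≤ Z i j) : maxDeg Y ≤ maxDeg Z :=
  maxDeg_le_iff.2 ⟨fun i => (Finset.sum_le_sum fun j _ => h i j).trans (row_le_maxDeg Z i),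
    fun j => (Finset.sum_le_sum fun i _ => h i j).trans (col_le_maxDeg Z j)⟩

theorem sum_intervalArrivals (r m : ℕ) :
    ∑ m' ∈ Finset.range m, intervalArrivals d M x r m' =
      arrivalsIn x (r * (M * d)) (r * (M * d) + m * d) := by
  induction m with
  | zero => simp [arrivalsIn]
  | succ m ih =>
    rw [Finset.sum_range_succ, ih]
    exact arrivalsIn_add x (Nat.le_add_right _ _) (by gcongr; omega)

theorem unfactored_add (r : ℕ) :
    unfactored d M k x r M + ∑ m ∈ Finset.range M, factor k (intervalArrivals d M x r m) =
      arrivalsIn x (r * (M * d)) (r * (M * d) + M * d) := by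
  rw [← sum_intervalArrivals, unfactored, ← Finset.sum_add_distrib]
  refine Finset.sum_congr rfl fun m _ => ?_
  ext i j
  exact Nat.sub_add_cancel (factor_le _ _ i j)

theorem maxDeg_backlog_succ_le (r : ℕ) :
    maxDeg (backlog d M k x (r + 1)) ≤
      maxDeg (backlog d M k x r) + maxDeg (unfactored d M k x r M) - (M * d - M * k) := by
  have h₁ := maxDeg_leftover_le (backlog d M k x r + unfactored d M k x r M) (M * d - M * k)
  have h₂ := maxDeg_add_le (backlog d M k x r) (unfactored d M k x r M)
  rw [backlog]
  omega

theorem maxDeg_backlog_succ_le_add (r : ℕ) :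
    maxDeg (backlog d M k x (r + 1)) ≤ maxDeg (backlog d M k x r) +
      maxDeg (arrivalsIn x (r * (M * d)) (r * (M * d) + M * d)) := by
  have h₁ := maxDeg_backlog_succ_le (d := d) (M := M) (k := k) (x := x) r
  have h₂ : maxDeg (unfactored d M k x r M) ≤
      maxDeg (arrivalsIn x (r * (M * d)) (r * (M * d) + M * d)) := by
    rw [← unfactored_add (k := k)]
    exact maxDeg_mono fun i j => Nat.le_add_right _ _
  omega

/-- Each factor takes exactly `k` from every row and every column, so removing `M` of them lowers
the maximal degree by exactly Mk. -/
theorem maxDeg_unfactored_add_le {r : ℕ}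
    (hgood : ∀ m < M, FactorCondition (intervalArrivals d M x r m) k) (hn : 0 < n) :
    maxDeg (unfactored d M k x r M) + M * k ≤
      maxDeg (arrivalsIn x (r * (M * d)) (r * (M * d) + M * d)) := by
  have hreg : ∀ m ∈ Finset.range M, RegularMatrix (factor k (intervalArrivals d M x r m)) k :=
    fun m hm => (hgood m (Finset.mem_range.1 hm)).regularMatrix_factor
  have hrow : ∀ i, ∑ j, unfactored d M k x r M i j + M * k ≤
      maxDeg (arrivalsIn x (r * (M * d)) (r * (M * d) + M * d)) := fun i => by
    refine le_trans (le_of_eq ?_) (row_le_maxDeg _ i)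
    rw [← unfactored_add (k := k)]
    simp only [Matrix.add_apply, Finset.sum_add_distrib, Matrix.sum_apply]
    rw [Finset.sum_comm, Finset.sum_congr rfl fun m hm => (hreg m hm).1 i]
    simp
  have hcol : ∀ j, ∑ i, unfactored d M k x r M i j + M * k ≤
      maxDeg (arrivalsIn x (r * (M * d)) (r * (M * d) + M * d)) := fun j => by
    refine le_trans (le_of_eq ?_) (col_le_maxDeg _ j)
    rw [← unfactored_add (k := k)]
    simp only [Matrix.add_apply, Finset.sum_add_distrib, Matrix.sum_apply]
    rw [Finset.sum_comm, Finset.sum_congr rfl fun m hm => (hreg m hm).2 j]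
    simp
  have h0 := hrow ⟨0, hn⟩
  have : maxDeg (unfactored d M k x r M) ≤
      maxDeg (arrivalsIn x (r * (M * d)) (r * (M * d) + M * d)) - M * k :=
    maxDeg_le_iff.2 ⟨fun i => by have := hrow i; omega, fun j => by have := hcol j; omega⟩
  omega

/-- The new packets use at most M(d - k) - 1 of the M(d - k) clearing slots; the spare slot reduces
the old backlog. -/
theorem maxDeg_backlog_succ_le_of_good {r : ℕ} (hn : 0 < n)
    (hgood : ∀ m < M, FactorCondition (intervalArrivals d M x r m) k)
    (hdeg : maxDeg (arrivalsIn x (r * (M * d)) (r * (M * d) + M * d)) < M * d) :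
    maxDeg (backlog d M k x (r + 1)) ≤ maxDeg (backlog d M k x r) - 1 := by
  have h₁ := maxDeg_backlog_succ_le (d := d) (M := M) (k := k) (x := x) r
  have h₂ := maxDeg_unfactored_add_le hgood hn
  omega

end Batching

/-! ### Functionals of finitely many slots. -/

section Slots

variable {n : ℕ} {Ω : Type*}

/-- The arrivals in the slots of `T`. -/
def restrictSlots (X : ℕ → Ω → SwitchMatrix n) (T : Finset ℕ) (ω : Ω) :
    (T ×ˢ (Finset.univ : Finset (Fin n × Fin n)) : Finset (ℕ × Fin n × Fin n)) → ℕ :=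
  fun e => X e.1.1 ω e.1.2.1 e.1.2.2

open Classical in
/-- The arrivals in the slots of `T`, continued by `0`. -/
def extendSlots (T : Finset ℕ)
    (z : (T ×ˢ (Finset.univ : Finset (Fin n × Fin n)) : Finset (ℕ × Fin n × Fin n)) → ℕ) :
    ℕ → SwitchMatrix n :=
  fun s i j => if h : s ∈ T then z ⟨(s, i, j), by simpa using h⟩ else 0

/-- Factoring through a finite family of natural numbers, a countable discrete space, makes
measurability automatic and reduces independence to disjointness of slot sets. -/
theorem comp_eq_comp_restrictSlots {β : Type*} {T : Finset ℕ} {f : (ℕ → SwitchMatrix n) → β}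
    (hf : DependsOn f (T : Set ℕ)) (X : ℕ → Ω → SwitchMatrix n) :
    (fun ω => f fun s => X s ω) = (f ∘ extendSlots T) ∘ restrictSlots X T := by
  funext ω
  refine hf fun s hs => ?_
  ext i j
  have : s ∈ T := hs
  simp [extendSlots, restrictSlots, this]

end Slots

/-! ### Bernoulli arrivals and Chernoff bounds. -/

section Bernoulli

variable {n : ℕ} {Ω : Type*} [MeasurableSpace Ω]

/-- Independent `0`-`1` valued arrivals with mean `p`. -/
structure BernoulliArray (P : Measure Ω) (p : ℝ) (X : ℕ → Ω → SwitchMatrix n) : Prop where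
  measurable : ∀ s i j, Measurable fun ω => X s ω i j
  le_one : ∀ s ω i j, X s ω i j ≤ 1
  mean : ∀ s i j, ∫ ω, (X s ω i j : ℝ) ∂P = p
  indep : iIndepFun (fun (e : ℕ × Fin n × Fin n) ω => X e.1 ω e.2.1 e.2.2) P

/-- The law only gives almost everywhere information; this version is measurable and `0`-`1` valued
at every point. -/
theorem IsBernoulliArrivals.exists_bernoulliArray {P : Measure Ω} {p : unitInterval}
    {a : ℕ → Ω → SwitchMatrix n} (h : IsBernoulliArrivals P p a) :
    ∃ X : ℕ → Ω → SwitchMatrix n, BernoulliArray P p X ∧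
      ∀ᵐ ω ∂P, (fun s => a s ω) = fun s => X s ω := by
  classical
  let Y : ℕ → Fin n → Fin n → Ω → ℕ := fun s i j => (h.hasLaw s i j).aemeasurable.mk
  have hYm : ∀ s i j, Measurable (Y s i j) := fun s i j =>
    (h.hasLaw s i j).aemeasurable.measurable_mk
  have hY : ∀ s i j, (fun ω => a s ω i j) =ᵐ[P] Y s i j := fun s i j =>
    (h.hasLaw s i j).aemeasurable.ae_eq_mk
  have h01 : ∀ s i j, ∀ᵐ ω ∂P, a s ω i j = 0 ∨ a s ω i j = 1 := fun s i j => by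
    have hm : Measurable fun m : ℕ => m = 0 ∨ m = 1 := measurable_from_top
    refine ((h.hasLaw s i j).ae_iff hm).2 ?_
    rw [ae_iff, bernoulliMeasure_apply p (MeasurableSet.of_discrete)]
    simp
  let X : ℕ → Ω → SwitchMatrix n := fun s ω i j => if Y s i j ω = 1 then 1 else 0
  have hX : ∀ s i j, (fun ω => a s ω i j) =ᵐ[P] fun ω => X s ω i j := fun s i j => by
    filter_upwards [hY s i j, h01 s i j] with ω h₁ h₂
    simp only [X]
    rw [← h₁]
    rcases h₂ with h₂ | h₂ <;> simp [h₂]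
  refine ⟨X, ⟨fun s i j => ?_, fun s ω i j => ?_, fun s i j => ?_, ?_⟩, ?_⟩
  · exact Measurable.ite ((hYm s i j) (MeasurableSet.singleton 1)) measurable_const measurable_const
  · simp only [X]; split_ifs <;> simp
  · have h₁ : ∫ ω, (X s ω i j : ℝ) ∂P = ∫ ω, ((a s ω i j : ℕ) : ℝ) ∂P :=
      integral_congr_ae ((hX s i j).mono fun ω hω => by simp only at hω; simp only [hω])
    have h₂ := (h.hasLaw s i j).integral_comp (f := fun m : ℕ => (m : ℝ))
      (measurable_from_top.aestronglyMeasurable)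
    rw [h₁]
    refine h₂.trans ?_
    rw [integral_bernoulliMeasure]
    simp
  · exact h.indep.congr fun e => hX e.1 e.2.1 e.2.2
  · have : ∀ᵐ ω ∂P, ∀ s i j, a s ω i j = X s ω i j :=
      ae_all_iff.2 fun s => ae_all_iff.2 fun i => ae_all_iff.2 fun j => hX s i j
    filter_upwards [this] with ω hω
    funext s
    ext i j
    exact hω s i j

namespace BernoulliArray

variable {P : Measure Ω} {p : ℝ} {X : ℕ → Ω → SwitchMatrix n}

theorem measurable_restrictSlots (hX : BernoulliArray P p X) (T : Finset ℕ) :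
    Measurable (restrictSlots X T) :=
  measurable_pi_lambda _ fun e => hX.measurable e.1.1 e.1.2.1 e.1.2.2

theorem measurable_comp {β : Type*} [MeasurableSpace β] (hX : BernoulliArray P p X) {T : Finset ℕ}
    {f : (ℕ → SwitchMatrix n) → β} (hf : DependsOn f (T : Set ℕ)) :
    Measurable fun ω => f fun s => X s ω := by
  rw [comp_eq_comp_restrictSlots hf]
  exact Measurable.of_discrete.comp (hX.measurable_restrictSlots T)

theorem exists_bound (hX : BernoulliArray P p X) {T : Finset ℕ} {f : (ℕ → SwitchMatrix n) → ℝ}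
    (hf : DependsOn f (T : Set ℕ)) : ∃ C, ∀ ω, ‖f fun s => X s ω‖ ≤ C := by
  classical
  have hfin : (Set.Icc 0 1 :
      Set ((T ×ˢ (Finset.univ : Finset (Fin n × Fin n)) : Finset (ℕ × Fin n × Fin n)) → ℕ)).Finite :=
    Set.finite_Icc _ _
  obtain ⟨C, hC⟩ := (hfin.image fun z => ‖f (extendSlots T z)‖).bddAbove
  refine ⟨C, fun ω => hC ⟨restrictSlots X T ω, ⟨fun _ => Nat.zero_le _, fun e => ?_⟩, ?_⟩⟩
  · exact hX.le_one _ _ _ _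
  · exact congrArg norm (congrFun (comp_eq_comp_restrictSlots hf X) ω).symm

theorem integrable_comp [IsFiniteMeasure P] (hX : BernoulliArray P p X) {T : Finset ℕ}
    {f : (ℕ → SwitchMatrix n) → ℝ} (hf : DependsOn f (T : Set ℕ)) :
    Integrable (fun ω => f fun s => X s ω) P := by
  obtain ⟨C, hC⟩ := hX.exists_bound hf
  exact Integrable.of_bound (hX.measurable_comp hf).aestronglyMeasurable C (ae_of_all _ hC)

theorem indepFun_comp {β γ : Type*} [MeasurableSpace β] [MeasurableSpace γ]
    (hX : BernoulliArray P p X) {T U : Finset ℕ} (hTU : Disjoint T U)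
    {f : (ℕ → SwitchMatrix n) → β} {g : (ℕ → SwitchMatrix n) → γ}
    (hf : DependsOn f (T : Set ℕ)) (hg : DependsOn g (U : Set ℕ)) :
    IndepFun (fun ω => f fun s => X s ω) (fun ω => g fun s => X s ω) P := by
  rw [comp_eq_comp_restrictSlots hf, comp_eq_comp_restrictSlots hg]
  exact (hX.indep.indepFun_finset _ _ (Finset.disjoint_product.2 (Or.inl hTU))
    fun e => hX.measurable e.1 e.2.1 e.2.2).comp Measurable.of_discrete Measurable.of_discrete

/-- The number of packets in a set of (slot, input, output) triples. -/
def count (F : Finset (ℕ × Fin n × Fin n)) (x : ℕ → SwitchMatrix n) : ℝ :=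
  ∑ e ∈ F, (x e.1 e.2.1 e.2.2 : ℝ)

theorem dependsOn_count (F : Finset (ℕ × Fin n × Fin n)) :
    DependsOn (count F) ((F.image Prod.fst : Finset ℕ) : Set ℕ) := fun x y h =>
  Finset.sum_congr rfl fun e he => by
    rw [h e.1 (Finset.mem_coe.2 (Finset.mem_image_of_mem _ he))]

theorem integral_count [IsFiniteMeasure P] (hX : BernoulliArray P p X)
    (F : Finset (ℕ × Fin n × Fin n)) : ∫ ω, count F (fun s => X s ω) ∂P = F.card * p := by
  simp only [count]
  rw [integral_finsetSum]
  · simp [hX.mean]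
  · intro e _
    exact hX.integrable_comp (T := {e.1}) (f := fun x => (x e.1 e.2.1 e.2.2 : ℝ))
      fun x y h => by simp only; rw [h e.1 (by simp)]

/-- A single arrival has moment generating function 1 + p(e^θ - 1), and e^θ - 1 ≤ θ + θ² for |θ| ≤
1. -/
theorem mgf_count_le [IsProbabilityMeasure P] (hX : BernoulliArray P p X)
    (F : Finset (ℕ × Fin n × Fin n)) (hp : 0 ≤ p) {θ : ℝ} (hθ : |θ| ≤ 1) :
    mgf (fun ω => count F fun s => X s ω) P θ ≤ Real.exp (F.card * p * (θ + θ ^ 2)) := by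
  have hind : iIndepFun (fun (e : ℕ × Fin n × Fin n) ω => (X e.1 ω e.2.1 e.2.2 : ℝ)) P :=
    hX.indep.comp (fun _ m => (m : ℝ)) fun _ => measurable_from_top
  have hmeas : ∀ e : ℕ × Fin n × Fin n, Measurable fun ω => (X e.1 ω e.2.1 e.2.2 : ℝ) := fun e =>
    measurable_from_top.comp (hX.measurable e.1 e.2.1 e.2.2)
  have hsum : (fun ω => count F fun s => X s ω) =
      ∑ e ∈ F, fun ω => (X e.1 ω e.2.1 e.2.2 : ℝ) := by
    funext ω; simp [count]
  have hone : ∀ e : ℕ × Fin n × Fin n,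
      mgf (fun ω => (X e.1 ω e.2.1 e.2.2 : ℝ)) P θ ≤ Real.exp (p * (θ + θ ^ 2)) := fun e => by
    have h₁ : mgf (fun ω => (X e.1 ω e.2.1 e.2.2 : ℝ)) P θ =
        ∫ ω, (1 + (Real.exp θ - 1) * (X e.1 ω e.2.1 e.2.2 : ℝ)) ∂P := by
      rw [mgf]
      refine integral_congr_ae (ae_of_all _ fun ω => ?_)
      rcases Nat.le_one_iff_eq_zero_or_eq_one.1 (hX.le_one e.1 ω e.2.1 e.2.2) with h | h <;>
        simp [h]
    have hint : Integrable (fun ω => (X e.1 ω e.2.1 e.2.2 : ℝ)) P :=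
      hX.integrable_comp (T := {e.1}) (f := fun x => (x e.1 e.2.1 e.2.2 : ℝ))
        fun x y h => by simp only; rw [h e.1 (by simp)]
    rw [h₁, integral_add (integrable_const _) (hint.const_mul _), integral_const_mul, hX.mean]
    simp only [integral_const, probReal_univ, smul_eq_mul, one_mul]
    have h₂ := abs_le.1 (Real.abs_exp_sub_one_sub_id_le hθ)
    have h₃ := Real.add_one_le_exp (p * (θ + θ ^ 2))
    have h₄ := mul_le_mul_of_nonneg_left h₂.2 hp
    linarith
  rw [hsum, hind.mgf_sum hmeas]
  calc ∏ e ∈ F, mgf (fun ω => (X e.1 ω e.2.1 e.2.2 : ℝ)) P θ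
      ≤ ∏ _e ∈ F, Real.exp (p * (θ + θ ^ 2)) :=
        Finset.prod_le_prod (fun e _ => mgf_nonneg) fun e _ => hone e
    _ = Real.exp (F.card * p * (θ + θ ^ 2)) := by
        rw [Finset.prod_const, ← Real.exp_nat_mul, mul_assoc]

theorem integrable_exp_count [IsFiniteMeasure P] (hX : BernoulliArray P p X)
    (F : Finset (ℕ × Fin n × Fin n)) (θ : ℝ) :
    Integrable (fun ω => Real.exp (θ * count F fun s => X s ω)) P :=
  hX.integrable_comp (T := F.image Prod.fst) (f := fun x => Real.exp (θ * count F x))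
    fun x y h => by simp only [dependsOn_count F h]

theorem upper_tail [IsProbabilityMeasure P] (hX : BernoulliArray P p X)
    (F : Finset (ℕ × Fin n × Fin n)) (hp : 0 ≤ p) {a s ν : ℝ} (hs : 0 ≤ s) (hν : 0 < ν)
    (hsν : s ≤ 2 * ν) (hmean : F.card * p ≤ ν) (ha : F.card * p + s ≤ a) :
    P.real {ω | a ≤ count F fun s => X s ω} ≤ Real.exp (-(s ^ 2 / (4 * ν))) := by
  -- The minimizer of -θs + νθ²; the assumption s ≤ 2ν keeps it at most `1`.
  set θ := s / (2 * ν) with hθ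
  have hθ0 : 0 ≤ θ := by positivity
  have hθ1 : θ ≤ 1 := by rw [hθ, div_le_one (by positivity)]; exact hsν
  refine (measure_ge_le_exp_mul_mgf a hθ0 (hX.integrable_exp_count F θ)).trans ?_
  refine (mul_le_mul_of_nonneg_left (hX.mgf_count_le F hp (abs_le.2 ⟨by linarith, hθ1⟩))
    (Real.exp_pos _).le).trans ?_
  rw [← Real.exp_add, Real.exp_le_exp]
  have h₁ : s ^ 2 / (4 * ν) = θ * s - ν * θ ^ 2 := by rw [hθ]; field_simp; ring
  rw [h₁]
  have h₂ := mul_le_mul_of_nonneg_left ha hθ0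
  have h₃ := mul_le_mul_of_nonneg_right hmean (sq_nonneg θ)
  linarith

theorem lower_tail [IsProbabilityMeasure P] (hX : BernoulliArray P p X)
    (F : Finset (ℕ × Fin n × Fin n)) (hp : 0 ≤ p) {a s ν : ℝ} (hs : 0 ≤ s) (hν : 0 < ν)
    (hsν : s ≤ 2 * ν) (hmean : F.card * p ≤ ν) (ha : a + s ≤ F.card * p) :
    P.real {ω | (count F fun s => X s ω) ≤ a} ≤ Real.exp (-(s ^ 2 / (4 * ν))) := by
  set θ := s / (2 * ν) with hθ
  have hθ0 : 0 ≤ θ := by positivity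
  have hθ1 : θ ≤ 1 := by rw [hθ, div_le_one (by positivity)]; exact hsν
  refine (measure_le_le_exp_mul_mgf a (neg_nonpos.2 hθ0) (hX.integrable_exp_count F (-θ))).trans ?_
  refine (mul_le_mul_of_nonneg_left (hX.mgf_count_le F hp (abs_le.2 ⟨by linarith, by linarith⟩))
    (Real.exp_pos _).le).trans ?_
  rw [← Real.exp_add, Real.exp_le_exp]
  have h₁ : s ^ 2 / (4 * ν) = θ * s - ν * θ ^ 2 := by rw [hθ]; field_simp; ring
  rw [h₁]
  have h₂ := mul_le_mul_of_nonneg_left ha hθ0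
  have h₃ := mul_le_mul_of_nonneg_right hmean (sq_nonneg θ)
  linarith

theorem blockSum_arrivalsIn (x : ℕ → SwitchMatrix n) (s t : ℕ) (I J : Finset (Fin n)) :
    (blockSum (arrivalsIn x s t) I J : ℝ) = count (Finset.Ico s t ×ˢ (I ×ˢ J)) x := by
  simp only [blockSum, arrivalsIn, Matrix.sum_apply, count, Finset.sum_product]
  push_cast
  rw [Finset.sum_comm]
  conv_rhs => rw [Finset.sum_comm]
  rw [Finset.sum_comm]
  refine Finset.sum_congr rfl fun i _ => ?_
  rw [Finset.sum_comm]

end BernoulliArray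

end Bernoulli

/-! ### Exponents in the union bound over pairs of sets. -/

section Exponents

/-- The exponent in the lower tail bound for the number of edges between `u` inputs and `v ≤ u`
outputs beats the number of such pairs of sets. -/
theorem exponent_le_of_le {n u v : ℕ} {d ℓ ρ k δ : ℝ} (hv : v ≤ u) (hu : u ≤ n)
    (huv : n < u + v) (hℓ : 0 ≤ ℓ) (hd : 18144 * ℓ ≤ d) (hd0 : 0 < d) (hρ : 1 / 2 ≤ ρ)
    (hδ : 0 ≤ δ) (hδd : 1024 * (d * ℓ) ≤ δ ^ 2) (hk : k ≤ ρ * d - δ) :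
    0 ≤ d * u * v * (ρ / n) - k * (u + v - n) ∧
      ((n - u) + v + 60) * ℓ ≤
        (d * u * v * (ρ / n) - k * (u + v - n)) ^ 2 / (4 * (d * u * v / n)) := by
  obtain ⟨x, rfl⟩ := Nat.exists_eq_add_of_le hu
  have hxv : x < v := by omega
  have hv0 : 0 < v := by omega
  have hvR : (1 : ℝ) ≤ v := by exact_mod_cast hv0
  have huR : (v : ℝ) ≤ u := by exact_mod_cast hv
  have hu1 : (1 : ℝ) ≤ u := by linarith
  have hxR : (0 : ℝ) ≤ x := Nat.cast_nonneg x
  have hxvR : (x : ℝ) + 1 ≤ v := by exact_mod_cast hxv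
  push_cast
  set N : ℝ := u + x with hN
  have hNpos : 0 < N := by linarith
  -- the deviation of the mean from the required number of edges
  set s : ℝ := d * u * v * (ρ / N) - k * (u + v - N) with hs
  -- With x = N - u, uv = N(v - x) + x(N - v): the surplus comes from the margin δ and from the
  -- edges of a nearly balanced pair.
  have hyx : (x : ℝ) * (N - v) * d * ρ / N + δ * (v - x) ≤ s := by
    have h₁ : d * u * v * (ρ / N) = ρ * d * (v - x) + x * (N - v) * d * ρ / N := by
      have : (u : ℝ) = N - x := by rw [hN]; ring
      rw [this]; field_simp; ring
    have h₂ : k * (u + v - N) ≤ (ρ * d - δ) * (v - x) := by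
      have : (u : ℝ) + v - N = v - x := by rw [hN]; ring
      rw [this]
      exact mul_le_mul_of_nonneg_right hk (by linarith)
    rw [hs, h₁]; linarith
  have hNv : 0 ≤ N - v := by rw [hN]; linarith
  have hA : 0 ≤ (x : ℝ) * (N - v) * d * ρ / N := by positivity
  have hB : 0 ≤ δ * (v - x) := mul_nonneg hδ (by linarith)
  refine ⟨by linarith, ?_⟩
  have hν : 4 * (d * u * v / N) ≤ 4 * (d * v) := by
    have : d * u * v / N ≤ d * v := by
      rw [div_le_iff₀ hNpos, hN]
      have : 0 ≤ d * v * x := by positivity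
      nlinarith
    linarith
  have hνpos : 0 < 4 * (d * u * v / N) := by positivity
  rw [le_div_iff₀ hνpos, show N - u + v + 60 = (x : ℝ) + v + 60 by rw [hN]; ring]
  refine (mul_le_mul_of_nonneg_left hν (by positivity)).trans ?_
  -- For 2x ≤ v the margin δ suffices. Otherwise N - v ≥ N/3 and the second source gives dx/6; the
  -- constant 18144 is 504 · 36.
  rcases le_total (2 * (x : ℝ)) v with hc | hc
  · have h₁ : δ * v / 2 ≤ s := by
      have : δ * v / 2 ≤ δ * (v - x) := by nlinarith
      linarith
    have h₂ : (δ * v / 2) ^ 2 ≤ s ^ 2 := pow_le_pow_left₀ (by positivity) h₁ 2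
    have h₃ : 256 * (d * ℓ) * v ^ 2 ≤ (δ * v / 2) ^ 2 := by nlinarith [sq_nonneg (v : ℝ)]
    have h₄ : ((x : ℝ) + v + 60) ≤ 64 * v := by linarith
    calc ((x : ℝ) + v + 60) * ℓ * (4 * (d * v)) ≤ 64 * v * ℓ * (4 * (d * v)) := by gcongr
      _ = 256 * (d * ℓ) * v ^ 2 := by ring
      _ ≤ s ^ 2 := h₃.trans h₂
  · have hx1 : (1 : ℝ) ≤ x := by
      have : 0 < x := by
        rcases Nat.eq_zero_or_pos x with rfl | h
        · simp only [Nat.cast_zero] at hc; linarith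
        · exact h
      exact_mod_cast this
    have hy : N ≤ 3 * (N - v) := by rw [hN]; linarith
    have h₁ : d * x / 6 ≤ s := by
      have : d * x / 6 ≤ (x : ℝ) * (N - v) * d * ρ / N := by
        rw [le_div_iff₀ hNpos]
        have h₂ : 0 ≤ d * x := by positivity
        have h₃ : N ≤ 6 * ((N - v) * ρ) := by nlinarith
        nlinarith
      linarith
    have h₂ : (d * x / 6) ^ 2 ≤ s ^ 2 := pow_le_pow_left₀ (by positivity) h₁ 2
    calc ((x : ℝ) + v + 60) * ℓ * (4 * (d * v))
        ≤ (x + 2 * x + 60 * x) * ℓ * (4 * (d * (2 * x))) := by gcongr; linarith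
      _ = d * x ^ 2 * (504 * ℓ) := by ring
      _ ≤ d * x ^ 2 * (d / 36) := by gcongr; linarith
      _ = (d * x / 6) ^ 2 := by ring
      _ ≤ s ^ 2 := h₂

/-- The sum is (1 + 1/n)^n by the binomial theorem. -/
theorem sum_powerset_exp_card_le {n : ℕ} (hn : 1 ≤ n) :
    ∑ J : Finset (Fin n), Real.exp (-(J.card * Real.log n)) ≤ Real.exp 1 := by
  have hnR : (0 : ℝ) < n := by exact_mod_cast hn
  have h₁ : ∀ J : Finset (Fin n), Real.exp (-(J.card * Real.log n)) =
      (1 / (n : ℝ)) ^ J.card * 1 ^ (n - J.card) := fun J => by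
    rw [one_pow, mul_one, ← mul_neg, Real.exp_nat_mul, Real.exp_neg, Real.exp_log hnR, one_div]
  simp only [h₁]
  have h₂ := Finset.sum_pow_mul_eq_add_pow (1 / (n : ℝ)) 1 (Finset.univ : Finset (Fin n))
  rw [Finset.powerset_univ, Finset.card_univ, Fintype.card_fin] at h₂
  rw [h₂]
  calc (1 / (n : ℝ) + 1) ^ n ≤ Real.exp (1 / n) ^ n :=
        pow_le_pow_left₀ (by positivity) (Real.add_one_le_exp _) n
    _ = Real.exp 1 := by
        rw [← Real.exp_nat_mul]; congr 1; field_simp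

theorem sum_exp_card_compl_le {n : ℕ} (hn : 1 ≤ n) :
    ∑ I : Finset (Fin n), Real.exp (-((n - I.card : ℝ) * Real.log n)) ≤ Real.exp 1 := by
  refine le_trans (le_of_eq ?_) (sum_powerset_exp_card_le hn)
  refine Fintype.sum_bijective compl compl_bijective _ _ fun I => ?_
  rw [Finset.card_compl, Fintype.card_fin, Nat.cast_sub ((Finset.card_le_univ I).trans_eq (by simp))]

end Exponents

/-! ### Probability that a batch is bad. -/

section Tails

variable {n : ℕ} {Ω : Type*} [MeasurableSpace Ω] {P : Measure Ω} [IsProbabilityMeasure P]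
  {X : ℕ → Ω → SwitchMatrix n} {ρ : ℝ}

/-- The two summands cover the cases |J| ≤ |I| and |I| ≤ |J|. Their product form lets the sum over
all pairs factor. -/
theorem prob_blockSum_lt_le (hX : BernoulliArray P (ρ / n) X) {d k : ℕ} {δ : ℝ}
    (hd : 18144 * Real.log n ≤ d) (hd0 : 0 < d) (hρ : 1 / 2 ≤ ρ) (hρ1 : ρ ≤ 1) (hδ : 0 ≤ δ)
    (hδd : 1024 * (d * Real.log n) ≤ δ ^ 2) (hk : k = 0 ∨ (k : ℝ) ≤ ρ * d - δ) (s : ℕ)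
    (I J : Finset (Fin n)) :
    P.real {ω | blockSum (arrivalsIn (fun s => X s ω) s (s + d)) I J + k * n <
        k * (I.card + J.card)} ≤
      Real.exp (-(60 * Real.log n)) *
        (Real.exp (-((n - I.card : ℝ) * Real.log n)) * Real.exp (-(J.card * Real.log n)) +
          Real.exp (-((n - J.card : ℝ) * Real.log n)) * Real.exp (-(I.card * Real.log n))) := by
  have hI : I.card ≤ n := (Finset.card_le_univ I).trans_eq (by simp)
  have hJ : J.card ≤ n := (Finset.card_le_univ J).trans_eq (by simp)
  by_cases huv : n < I.card + J.card ∧ k ≠ 0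
  swap
  · have : {ω | blockSum (arrivalsIn (fun s => X s ω) s (s + d)) I J + k * n <
        k * (I.card + J.card)} = ∅ := by
      refine Set.eq_empty_of_forall_notMem fun ω hω => ?_
      have hω' : blockSum (arrivalsIn (fun s => X s ω) s (s + d)) I J + k * n <
        k * (I.card + J.card) := hω
      rcases not_and_or.1 huv with h | h
      · have := Nat.mul_le_mul_left k (not_lt.1 h)
        omega
      · simp [not_not.1 h] at hω'
    rw [this, measureReal_empty]
    positivity
  obtain ⟨huv, hk0⟩ := huv
  have hk' : (k : ℝ) ≤ ρ * d - δ := hk.resolve_left hk0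
  have hn0 : 0 < n := by omega
  have hnR : (0 : ℝ) < n := by exact_mod_cast hn0
  have hu0 : (0 : ℝ) < I.card := by exact_mod_cast (by omega : 0 < I.card)
  have hv0 : (0 : ℝ) < J.card := by exact_mod_cast (by omega : 0 < J.card)
  have hdR : (0 : ℝ) < d := by exact_mod_cast hd0
  have hℓ : 0 ≤ Real.log n := Real.log_natCast_nonneg n
  have hmain : 0 ≤ (d : ℝ) * I.card * J.card * (ρ / n) - k * (I.card + J.card - n) ∧
      (((n - I.card : ℝ) + J.card + 60) * Real.log n ≤
        ((d : ℝ) * I.card * J.card * (ρ / n) - k * (I.card + J.card - n)) ^ 2 /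
          (4 * (d * I.card * J.card / n)) ∨
      ((n - J.card : ℝ) + I.card + 60) * Real.log n ≤
        ((d : ℝ) * I.card * J.card * (ρ / n) - k * (I.card + J.card - n)) ^ 2 /
          (4 * (d * I.card * J.card / n))) := by
    rcases le_total J.card I.card with h | h
    · have := exponent_le_of_le h hI huv hℓ hd hdR hρ hδ hδd hk'
      exact ⟨this.1, Or.inl this.2⟩
    · have := exponent_le_of_le h hJ (by omega) hℓ hd hdR hρ hδ hδd hk'
      rw [mul_right_comm (d : ℝ) J.card, add_comm (J.card : ℝ)] at this
      exact ⟨this.1, Or.inr this.2⟩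
  set S : ℝ := (d : ℝ) * I.card * J.card * (ρ / n) - k * (I.card + J.card - n) with hS
  set ν : ℝ := d * I.card * J.card / n with hν
  have hν0 : 0 < ν := by positivity
  set F : Finset (ℕ × Fin n × Fin n) := Finset.Ico s (s + d) ×ˢ (I ×ˢ J) with hF
  have hcard : (F.card : ℝ) * (ρ / n) = d * I.card * J.card * (ρ / n) := by
    rw [hF, Finset.card_product, Finset.card_product, Nat.card_Ico, Nat.add_sub_cancel_left]
    push_cast
    ring
  have hmean : (F.card : ℝ) * (ρ / n) ≤ ν := by
    rw [hcard, hν, ← mul_div_assoc]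
    exact div_le_div_of_nonneg_right (mul_le_of_le_one_right (by positivity) hρ1) hnR.le
  have huvR : (n : ℝ) ≤ I.card + J.card := by exact_mod_cast huv.le
  have hkS : 0 ≤ (k : ℝ) * (I.card + J.card - n) :=
    mul_nonneg (Nat.cast_nonneg k) (by linarith)
  have htail := hX.lower_tail F (by positivity) (a := k * (I.card + J.card - n)) (s := S)
    (ν := ν) hmain.1 hν0 (by rw [hcard] at hmean; linarith) hmean (by rw [hcard, hS]; linarith)
  have hsub : P.real {ω | blockSum (arrivalsIn (fun s => X s ω) s (s + d)) I J + k * n <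
      k * (I.card + J.card)} ≤ Real.exp (-(S ^ 2 / (4 * ν))) := by
    refine (measureReal_mono fun ω hω => ?_).trans htail
    have hω' : blockSum (arrivalsIn (fun s => X s ω) s (s + d)) I J + k * n <
        k * (I.card + J.card) := hω
    have h₁ : (blockSum (arrivalsIn (fun s => X s ω) s (s + d)) I J : ℝ) + k * n <
        k * (I.card + J.card) := by exact_mod_cast hω'
    rw [BernoulliArray.blockSum_arrivalsIn] at h₁
    change BernoulliArray.count F (fun s => X s ω) ≤ _
    linarith
  refine hsub.trans ?_
  rw [mul_add, ← Real.exp_add, ← Real.exp_add, ← Real.exp_add, ← Real.exp_add]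
  rcases hmain.2 with h | h
  · refine le_add_of_le_of_nonneg (Real.exp_le_exp.2 ?_) (Real.exp_pos _).le
    linarith
  · refine le_add_of_nonneg_of_le (Real.exp_pos _).le (Real.exp_le_exp.2 ?_)
    linarith

/-- With high probability the arrivals in an interval contain a `k`-factor. -/
theorem prob_not_factorCondition_le (hX : BernoulliArray P (ρ / n) X) (hn : 1 ≤ n) {d k : ℕ}
    {δ : ℝ} (hd : 18144 * Real.log n ≤ d) (hd0 : 0 < d) (hρ : 1 / 2 ≤ ρ) (hρ1 : ρ ≤ 1)
    (hδ : 0 ≤ δ) (hδd : 1024 * (d * Real.log n) ≤ δ ^ 2)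
    (hk : k = 0 ∨ (k : ℝ) ≤ ρ * d - δ) (s : ℕ) :
    P.real {ω | ¬ FactorCondition (arrivalsIn (fun s => X s ω) s (s + d)) k} ≤
      16 * Real.exp (-(60 * Real.log n)) := by
  have hset : {ω | ¬ FactorCondition (arrivalsIn (fun s => X s ω) s (s + d)) k} =
      ⋃ IJ : Finset (Fin n) × Finset (Fin n),
        {ω | blockSum (arrivalsIn (fun s => X s ω) s (s + d)) IJ.1 IJ.2 + k * n <
          k * (IJ.1.card + IJ.2.card)} := by
    ext ω
    simp [FactorCondition, Prod.exists]
  rw [hset]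
  refine (measureReal_iUnion_fintype_le _).trans ?_
  refine (Finset.sum_le_sum fun IJ _ =>
    prob_blockSum_lt_le hX hd hd0 hρ hρ1 hδ hδd hk s IJ.1 IJ.2).trans ?_
  have h₁ := sum_powerset_exp_card_le hn
  have h₂ := sum_exp_card_compl_le hn
  have h₃ : (0 : ℝ) ≤ ∑ J : Finset (Fin n), Real.exp (-(J.card * Real.log n)) := by positivity
  have h₄ := mul_le_mul h₂ h₁ h₃ (Real.exp_pos 1).le
  have he : Real.exp 1 * Real.exp 1 ≤ 8 := by
    have := Real.exp_one_lt_d9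
    have := Real.exp_pos 1
    nlinarith
  rw [← Finset.mul_sum, mul_comm]
  refine mul_le_mul_of_nonneg_right ?_ (Real.exp_pos _).le
  rw [Finset.sum_add_distrib, Fintype.sum_prod_type, Fintype.sum_prod_type]
  dsimp only
  rw [← Finset.sum_mul_sum]
  conv_lhs => arg 2; rw [Finset.sum_comm]
  rw [← Finset.sum_mul_sum]
  linarith

/-- Rows and columns are both blocks with `n` cells. The mean is b - b/n, and a deviation b/n costs
the exponent b/(4n²), hence the constant 240 = 4 · 60. -/
theorem prob_row_or_col_ge_le (hX : BernoulliArray P (ρ / n) X) (hn : 1 ≤ n) {b : ℕ}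
    (hρ0 : 0 ≤ ρ) (hρ : ρ = 1 - 1 / n) (hb : 240 * ((n : ℝ) ^ 2 * Real.log n) ≤ b) (hb0 : 0 < b)
    (s : ℕ) (I J : Finset (Fin n)) (hIJ : I.card * J.card = n) :
    P.real {ω | b ≤ blockSum (arrivalsIn (fun s => X s ω) s (s + b)) I J} ≤
      Real.exp (-(60 * Real.log n)) := by
  have hnR : (1 : ℝ) ≤ n := by exact_mod_cast hn
  have hbR : (0 : ℝ) < b := by exact_mod_cast hb0
  set F : Finset (ℕ × Fin n × Fin n) := Finset.Ico s (s + b) ×ˢ (I ×ˢ J) with hF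
  have hcard : (F.card : ℝ) * (ρ / n) = b - b / n := by
    rw [hF, Finset.card_product, Finset.card_product, Nat.card_Ico, Nat.add_sub_cancel_left, hIJ,
      hρ]
    push_cast
    field_simp
  have hbn : (b : ℝ) / n ≤ b := div_le_self hbR.le hnR
  have hbn0 : 0 ≤ (b : ℝ) / n := by positivity
  have htail := hX.upper_tail F (by positivity) (a := b) (s := b / n) (ν := b) (by positivity) hbR
    (by linarith) (by linarith) (by linarith)
  have hset : {ω | b ≤ blockSum (arrivalsIn (fun s => X s ω) s (s + b)) I J} =
      {ω | (b : ℝ) ≤ BernoulliArray.count F fun s => X s ω} := by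
    ext ω
    rw [Set.mem_ofPred_eq, Set.mem_ofPred_eq, ← BernoulliArray.blockSum_arrivalsIn, Nat.cast_le]
  rw [hset]
  refine htail.trans (Real.exp_le_exp.2 (neg_le_neg ?_))
  rw [show ((b : ℝ) / n) ^ 2 / (4 * b) = b / (4 * n ^ 2) by field_simp]
  rw [le_div_iff₀ (by positivity)]
  linarith

theorem prob_maxDeg_ge_le (hX : BernoulliArray P (ρ / n) X) (hn : 1 ≤ n) {b : ℕ}
    (hρ0 : 0 ≤ ρ) (hρ : ρ = 1 - 1 / n) (hb : 240 * ((n : ℝ) ^ 2 * Real.log n) ≤ b) (hb0 : 0 < b)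
    (s : ℕ) :
    P.real {ω | ¬ maxDeg (arrivalsIn (fun s => X s ω) s (s + b)) < b} ≤
      2 * n * Real.exp (-(60 * Real.log n)) := by
  have hset : {ω | ¬ maxDeg (arrivalsIn (fun s => X s ω) s (s + b)) < b} ⊆
      (⋃ i : Fin n, {ω | b ≤ blockSum (arrivalsIn (fun s => X s ω) s (s + b)) {i} Finset.univ}) ∪
      ⋃ j : Fin n, {ω | b ≤ blockSum (arrivalsIn (fun s => X s ω) s (s + b)) Finset.univ {j}} := by
    intro ω hω
    by_contra hcon
    apply hω
    simp only [Set.mem_union, Set.mem_iUnion, Set.mem_ofPred_eq, not_or, not_exists, not_le,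
      blockSum, Finset.sum_singleton] at hcon
    have : maxDeg (arrivalsIn (fun s => X s ω) s (s + b)) ≤ b - 1 :=
      maxDeg_le_iff.2 ⟨fun i => Nat.le_sub_one_of_lt (hcon.1 i),
        fun j => Nat.le_sub_one_of_lt (hcon.2 j)⟩
    omega
  refine (measureReal_mono hset).trans ((measureReal_union_le _ _).trans ?_)
  have h₁ : P.real (⋃ i : Fin n,
      {ω | b ≤ blockSum (arrivalsIn (fun s => X s ω) s (s + b)) {i} Finset.univ}) ≤
      n * Real.exp (-(60 * Real.log n)) := by
    refine (measureReal_iUnion_fintype_le _).trans ((Finset.sum_le_sum fun i _ =>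
      prob_row_or_col_ge_le hX hn hρ0 hρ hb hb0 s {i} Finset.univ (by simp)).trans ?_)
    simp
  have h₂ : P.real (⋃ j : Fin n,
      {ω | b ≤ blockSum (arrivalsIn (fun s => X s ω) s (s + b)) Finset.univ {j}}) ≤
      n * Real.exp (-(60 * Real.log n)) := by
    refine (measureReal_iUnion_fintype_le _).trans ((Finset.sum_le_sum fun j _ =>
      prob_row_or_col_ge_le hX hn hρ0 hρ hb hb0 s Finset.univ {j} (by simp)).trans ?_)
    simp
  linarith

end Tails

/-! ### Lyapunov drift of the backlog. -/

section Drift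

variable {n : ℕ} {d M k : ℕ}

theorem arrivalsIn_congr_of_mem_Ico {x y : ℕ → SwitchMatrix n} {s t : ℕ}
    (h : ∀ u ∈ Finset.Ico s t, x u = y u) : arrivalsIn x s t = arrivalsIn y s t :=
  Finset.sum_congr rfl h

variable (d M k) in
/-- All `k`-factors of batch `r` exist, and the batch can be cleared with one slot to spare. -/
def GoodBatch (r : ℕ) (x : ℕ → SwitchMatrix n) : Prop :=
  (∀ m < M, FactorCondition (intervalArrivals d M x r m) k) ∧
    maxDeg (arrivalsIn x (r * (M * d)) (r * (M * d) + M * d)) < M * d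

open Classical in
variable (d M k) in
/-- The indicator of the event that batch `r` is not good. -/
noncomputable def badIndicator (r : ℕ) (x : ℕ → SwitchMatrix n) : ℝ :=
  if GoodBatch d M k r x then 0 else 1

theorem dependsOn_goodBatch (r : ℕ) :
    DependsOn (GoodBatch (n := n) d M k r)
      (Finset.Ico (r * (M * d)) (r * (M * d) + M * d) : Finset ℕ) := fun x y h => by
  have h' : ∀ u ∈ Finset.Ico (r * (M * d)) (r * (M * d) + M * d), x u = y u := h
  have h₁ : ∀ m < M, intervalArrivals d M x r m = intervalArrivals d M y r m := fun m hm =>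
    arrivalsIn_congr_of_mem_Ico fun u hu => h' u <| by
      have : (m + 1) * d ≤ M * d := Nat.mul_le_mul_right d hm
      rw [Finset.mem_Ico] at hu ⊢
      omega
  simp only [GoodBatch, arrivalsIn_congr_of_mem_Ico h', eq_iff_iff]
  refine and_congr_left fun _ => forall₂_congr fun m hm => ?_
  rw [h₁ m hm]

theorem dependsOn_badIndicator (r : ℕ) :
    DependsOn (badIndicator (n := n) d M k r)
      (Finset.Ico (r * (M * d)) (r * (M * d) + M * d) : Finset ℕ) := fun x y h => by
  classical
  exact if_congr (iff_of_eq (dependsOn_goodBatch r h)) rfl rfl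

theorem dependsOn_backlog (r : ℕ) :
    DependsOn (fun x : ℕ → SwitchMatrix n => backlog d M k x r)
      (Finset.range (r * (M * d)) : Finset ℕ) := fun _ _ h =>
  backlog_congr fun s hs => h s (by simpa using hs)

theorem arrivalsIn_le {x : ℕ → SwitchMatrix n} (hx : ∀ s i j, x s i j ≤ 1) (s b : ℕ)
    (i j : Fin n) : arrivalsIn x s (s + b) i j ≤ b := by
  rw [arrivalsIn, Matrix.sum_apply]
  exact (Finset.sum_le_card_nsmul _ _ 1 fun u _ => hx u i j).trans_eq (by simp)

theorem maxDeg_arrivalsIn_le {x : ℕ → SwitchMatrix n} (hx : ∀ s i j, x s i j ≤ 1) (s b : ℕ) :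
    maxDeg (arrivalsIn x s (s + b)) ≤ n * b :=
  maxDeg_le_iff.2 ⟨fun i => (Finset.sum_le_card_nsmul _ _ b
      fun j _ => arrivalsIn_le hx s b i j).trans_eq (by simp),
    fun j => (Finset.sum_le_card_nsmul _ _ b
      fun i _ => arrivalsIn_le hx s b i j).trans_eq (by simp)⟩

theorem one_add_inv_pow_self_le (W : ℕ) : (1 + 1 / (W : ℝ)) ^ W ≤ 3 := by
  rcases Nat.eq_zero_or_pos W with rfl | hW
  · norm_num
  have hWR : (0 : ℝ) < W := by exact_mod_cast hW
  calc (1 + 1 / (W : ℝ)) ^ W ≤ Real.exp (1 / W) ^ W := by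
        refine pow_le_pow_left₀ (by positivity) ?_ W
        rw [add_comm]
        exact Real.add_one_le_exp _
    _ = Real.exp 1 := by rw [← Real.exp_nat_mul]; congr 1; field_simp
    _ ≤ 3 := by linarith [Real.exp_one_lt_d9]

variable (n d M k) in
/-- The exponential Lyapunov function of the backlog. -/
noncomputable def lyapunov (r : ℕ) (x : ℕ → SwitchMatrix n) : ℝ :=
  (1 + 1 / ((n * (M * d) : ℕ) : ℝ)) ^ maxDeg (backlog d M k x r) - 1

theorem dependsOn_lyapunov (r : ℕ) :
    DependsOn (lyapunov n d M k r) (Finset.range (r * (M * d)) : Finset ℕ) := fun x y h => by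
  have := dependsOn_backlog (k := k) r h
  dsimp only at this
  simp only [lyapunov, this]

theorem lyapunov_nonneg (r : ℕ) (x : ℕ → SwitchMatrix n) : 0 ≤ lyapunov n d M k r x :=
  sub_nonneg.2 (one_le_pow₀ (le_add_of_nonneg_right (by positivity)))

/-- With W = nMd, a good batch divides the power by 1 + 1/W unless the backlog is empty. A bad one
adds at most W to the degree, which multiplies the power by at most (1 + 1/W)^W ≤ 3. -/
theorem lyapunov_succ_le (hn : 0 < n) (hb : 0 < M * d) {x : ℕ → SwitchMatrix n}
    (hx : ∀ s i j, x s i j ≤ 1) (r : ℕ) :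
    lyapunov n d M k (r + 1) x ≤
      (1 - 1 / (((n * (M * d) : ℕ) : ℝ) + 1)) * lyapunov n d M k r x +
        badIndicator d M k r x * (3 * lyapunov n d M k r x + 2) := by
  have hW : (0 : ℝ) < ((n * (M * d) : ℕ) : ℝ) := by exact_mod_cast Nat.mul_pos hn hb
  have h3 := one_add_inv_pow_self_le (n * (M * d))
  have hg := lyapunov_nonneg (d := d) (M := M) (k := k) r x
  unfold lyapunov at hg ⊢
  set W : ℝ := ((n * (M * d) : ℕ) : ℝ) with hWdef
  set γ : ℝ := 1 + 1 / W with hγ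
  have hγ1 : 1 ≤ γ := le_add_of_nonneg_right (by positivity)
  have hinv : (1 - 1 / (W + 1)) * γ = 1 := by rw [hγ]; field_simp; ring
  have hc0 : 0 ≤ 1 - 1 / (W + 1) := by
    rw [sub_nonneg, div_le_one (by positivity)]; linarith
  have hc1 : 1 - 1 / (W + 1) ≤ 1 := sub_le_self _ (by positivity)
  unfold badIndicator
  split_ifs with hgood
  · have h₁ := maxDeg_backlog_succ_le_of_good hn hgood.1 hgood.2
    rw [zero_mul, add_zero]
    refine (sub_le_sub_right (pow_le_pow_right₀ hγ1 h₁) 1).trans ?_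
    rcases Nat.eq_zero_or_pos (maxDeg (backlog d M k x r)) with h0 | hpos
    · simp [h0]
    · obtain ⟨D, hD⟩ := Nat.exists_eq_add_of_le' hpos
      rw [hD, Nat.add_sub_cancel, pow_succ, mul_sub, mul_comm (γ ^ D), ← mul_assoc, hinv]
      linarith
  · have h₁ := maxDeg_backlog_succ_le_add (d := d) (M := M) (k := k) (x := x) r
    have h₂ := maxDeg_arrivalsIn_le hx (r * (M * d)) (M * d)
    have h₄ := pow_le_pow_right₀ hγ1 (h₁.trans (Nat.add_le_add_left h₂ _))
    rw [pow_add] at h₄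
    have h₅ := mul_le_mul_of_nonneg_left h3 (by positivity : 0 ≤ γ ^ maxDeg (backlog d M k x r))
    have h₆ := mul_nonneg hc0 hg
    linarith

theorem maxDeg_backlog_le_lyapunov (hn : 0 < n) (hb : 0 < M * d) (r : ℕ)
    (x : ℕ → SwitchMatrix n) :
    (maxDeg (backlog d M k x r) : ℝ) ≤ ((n * (M * d) : ℕ) : ℝ) * lyapunov n d M k r x := by
  have hW : (0 : ℝ) < ((n * (M * d) : ℕ) : ℝ) := by exact_mod_cast Nat.mul_pos hn hb
  have h := one_add_mul_le_pow (a := 1 / ((n * (M * d) : ℕ) : ℝ))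
    (le_trans (by norm_num) (by positivity : (0 : ℝ) ≤ 1 / ((n * (M * d) : ℕ) : ℝ)))
    (maxDeg (backlog d M k x r))
  have h₂ : (maxDeg (backlog d M k x r) : ℝ) * (1 / ((n * (M * d) : ℕ) : ℝ)) ≤
      lyapunov n d M k r x := by unfold lyapunov; linarith
  rw [mul_one_div, div_le_iff₀ hW] at h₂
  linarith

variable {Ω : Type*} [MeasurableSpace Ω] {P : Measure Ω} [IsProbabilityMeasure P]
  {X : ℕ → Ω → SwitchMatrix n} {p : ℝ}

/-- Whether batch `r` is bad is independent of the backlog before it. The assumption on ε lets the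
growth 3ε use at most half of the contraction 1/(W + 1); the bound is the fixed point of g ↦ (1 -
1/(2(W + 1)))g + 2ε. -/
theorem integral_lyapunov_le (hX : BernoulliArray P p X) (hn : 0 < n) (hb : 0 < M * d) {ε : ℝ}
    (hε : 0 ≤ ε) (hbad : ∀ r, ∫ ω, badIndicator d M k r (fun s => X s ω) ∂P ≤ ε)
    (hεW : 6 * ε * (((n * (M * d) : ℕ) : ℝ) + 1) ≤ 1) (r : ℕ) :
    ∫ ω, lyapunov n d M k r (fun s => X s ω) ∂P ≤ 4 * ε * (((n * (M * d) : ℕ) : ℝ) + 1) := by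
  induction r with
  | zero =>
    have : ∀ x : ℕ → SwitchMatrix n, lyapunov n d M k 0 x = 0 := fun x => by
      simp [lyapunov, backlog, maxDeg_zero]
    simp only [this, integral_zero]
    positivity
  | succ r ih =>
    have hi₀ := hX.integrable_comp (dependsOn_lyapunov (d := d) (M := M) (k := k) (r + 1))
    have hi₁ := hX.integrable_comp (dependsOn_lyapunov (d := d) (M := M) (k := k) r)
    have hi₂ := hX.integrable_comp (dependsOn_badIndicator (d := d) (M := M) (k := k) r)
    have hdep : DependsOn (fun x => 3 * lyapunov n d M k r x + 2)
        (Finset.range (r * (M * d)) : Finset ℕ) := fun x y h => by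
      simp only [dependsOn_lyapunov r h]
    have hdisj : Disjoint (Finset.Ico (r * (M * d)) (r * (M * d) + M * d))
        (Finset.range (r * (M * d))) := by
      rw [Finset.disjoint_left]
      intro u hu hu'
      simp only [Finset.mem_Ico, Finset.mem_range] at hu hu'
      omega
    have hind := hX.indepFun_comp hdisj (dependsOn_badIndicator (k := k) r) hdep
    have hi₃ := hX.integrable_comp hdep
    have hi₄ : Integrable (fun ω => badIndicator d M k r (fun s => X s ω) *
        (3 * lyapunov n d M k r (fun s => X s ω) + 2)) P := hind.integrable_mul hi₂ hi₃
    have hprod := hind.integral_fun_mul_eq_mul_integral hi₂.aestronglyMeasurable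
      hi₃.aestronglyMeasurable
    have hlin : ∫ ω, (3 * lyapunov n d M k r (fun s => X s ω) + 2) ∂P =
        3 * ∫ ω, lyapunov n d M k r (fun s => X s ω) ∂P + 2 := by
      rw [integral_add (hi₁.const_mul 3) (integrable_const _), integral_const_mul]
      simp
    have hstep : ∫ ω, lyapunov n d M k (r + 1) (fun s => X s ω) ∂P ≤
        ∫ ω, ((1 - 1 / (((n * (M * d) : ℕ) : ℝ) + 1)) * lyapunov n d M k r (fun s => X s ω) +
          badIndicator d M k r (fun s => X s ω) *
            (3 * lyapunov n d M k r (fun s => X s ω) + 2)) ∂P :=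
      integral_mono hi₀ ((hi₁.const_mul _).add hi₄) fun ω =>
        lyapunov_succ_le hn hb (fun s i j => hX.le_one s ω i j) r
    refine hstep.trans ?_
    rw [integral_add (hi₁.const_mul _) hi₄, integral_const_mul, hprod, hlin]
    have hG : 0 ≤ ∫ ω, lyapunov n d M k r (fun s => X s ω) ∂P :=
      integral_nonneg fun ω => lyapunov_nonneg r _
    set G := ∫ ω, lyapunov n d M k r (fun s => X s ω) ∂P with hGdef
    set W : ℝ := ((n * (M * d) : ℕ) : ℝ) with hW
    have hW0 : 0 ≤ W := Nat.cast_nonneg _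
    have h₁ := mul_le_mul_of_nonneg_right (hbad r) (by positivity : 0 ≤ 3 * G + 2)
    have h₂ : 3 * ε ≤ 1 / 2 * (1 / (W + 1)) := by
      rw [mul_one_div, le_div_iff₀ (by positivity)]; linarith
    have h₃ : 1 / (W + 1) ≤ 1 := by rw [div_le_one (by positivity)]; linarith
    have h₄ : (1 - 1 / 2 * (1 / (W + 1))) * G ≤
        (1 - 1 / 2 * (1 / (W + 1))) * (4 * ε * (W + 1)) :=
      mul_le_mul_of_nonneg_left ih (by linarith)
    have h₅ : (1 - 1 / 2 * (1 / (W + 1))) * (4 * ε * (W + 1)) = 4 * ε * (W + 1) - 2 * ε := by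
      field_simp; ring
    have h₆ := mul_le_mul_of_nonneg_right h₂ hG
    linarith

end Drift

/-! ### The mean queue size in terms of the parameters. -/

section QueueBound

variable {n d M k : ℕ} {Ω : Type*} [MeasurableSpace Ω] {P : Measure Ω} [IsProbabilityMeasure P]
  {X : ℕ → Ω → SwitchMatrix n} {p : ℝ}

theorem total_arrivalsIn_eq_count (x : ℕ → SwitchMatrix n) (s t : ℕ) :
    (total (arrivalsIn x s t) : ℝ) =
      BernoulliArray.count (Finset.Ico s t ×ˢ (Finset.univ ×ˢ Finset.univ)) x :=
  BernoulliArray.blockSum_arrivalsIn x s t Finset.univ Finset.univ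

theorem dependsOn_total_arrivalsIn (s t : ℕ) :
    DependsOn (fun x : ℕ → SwitchMatrix n => (total (arrivalsIn x s t) : ℝ))
      (Finset.Ico s t : Finset ℕ) := fun x y h => by
  simp only [arrivalsIn_congr_of_mem_Ico h]

theorem integral_total_arrivalsIn (hX : BernoulliArray P p X) {s t : ℕ} (hst : s ≤ t) :
    ∫ ω, (total (arrivalsIn (fun s => X s ω) s t) : ℝ) ∂P = (t - s : ℝ) * n ^ 2 * p := by
  simp only [total_arrivalsIn_eq_count]
  rw [hX.integral_count, Finset.card_product, Nat.card_Ico]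
  simp only [Finset.univ_product_univ, Finset.card_univ, Fintype.card_prod, Fintype.card_fin]
  push_cast [Nat.cast_sub hst]
  ring

theorem SchedulingPolicy.state_congr (π : SchedulingPolicy n) {x y : ℕ → SwitchMatrix n} {t : ℕ}
    (h : ∀ s < t, x s = y s) : π.state x t = π.state y t := by
  induction t with
  | zero => rfl
  | succ t ih =>
    rw [SchedulingPolicy.state, SchedulingPolicy.state, ih fun s hs => h s (by omega),
      h t (Nat.lt_succ_self t)]

theorem SchedulingPolicy.dependsOn_total_queue (π : SchedulingPolicy n) (t : ℕ) :
    DependsOn (fun x : ℕ → SwitchMatrix n => (total (π.queue x t) : ℝ))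
      (Finset.range t : Finset ℕ) := fun x y h => by
  simp only [SchedulingPolicy.queue,
    π.state_congr (t := t) fun s hs => h s (by simpa using hs)]

theorem integral_total_queue_le_arrivals (hX : BernoulliArray P p X) (π : SchedulingPolicy n)
    (t : ℕ) : ∫ ω, (total (π.queue (fun s => X s ω) t) : ℝ) ∂P ≤ t * n ^ 2 * p := by
  have h := integral_total_arrivalsIn hX (Nat.zero_le t)
  rw [Nat.cast_zero, sub_zero] at h
  rw [← h]
  refine integral_mono (hX.integrable_comp (π.dependsOn_total_queue t))
    (hX.integrable_comp (dependsOn_total_arrivalsIn 0 t)) fun ω => ?_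
  exact Nat.cast_le.2 (total_mono (queue_le_arrivals π t))

/-- The mean total queue size under the batching policy. -/
theorem integral_total_queue_le (hX : BernoulliArray P p X) (hn : 0 < n) (hb : 0 < M * d)
    (hkd : k ≤ d) (hp : n * p ≤ 1) {ε : ℝ}
    (hε : 0 ≤ ε) (hbad : ∀ r, ∫ ω, badIndicator d M k r (fun s => X s ω) ∂P ≤ ε)
    (hεW : 6 * ε * (((n * (M * d) : ℕ) : ℝ) + 1) ≤ 1) {π : SchedulingPolicy n}
    (hπ : ∀ x t, π.schedule (π.queue x t) (π.past x t) = batchSchedule d M k x t) (t : ℕ) :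
    ∫ ω, (total (π.queue (fun s => X s ω) t) : ℝ) ∂P ≤ 2 * n * (startSlot d M k : ℝ) +
      5 * n * (ε * (((n * (M * d) : ℕ) : ℝ) + 1) * ((n * (M * d) : ℕ) : ℝ)) := by
  have hnR : (0 : ℝ) < n := by exact_mod_cast hn
  have hn1 : (1 : ℝ) ≤ n := by exact_mod_cast hn
  have hW0 : (0 : ℝ) ≤ ((n * (M * d) : ℕ) : ℝ) := Nat.cast_nonneg _
  have hS0 : (0 : ℝ) ≤ startSlot d M k := Nat.cast_nonneg _
  have hrest : 0 ≤ 5 * n * (ε * (((n * (M * d) : ℕ) : ℝ) + 1) * ((n * (M * d) : ℕ) : ℝ)) := by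
    positivity
  rcases Nat.lt_or_ge t (startSlot d M k) with ht | ht
  · refine (integral_total_queue_le_arrivals hX π t).trans ?_
    have h₁ : (t : ℝ) ≤ startSlot d M k := by exact_mod_cast ht.le
    have h₂ : (t : ℝ) * n ^ 2 * p ≤ t * n * 1 := by
      calc (t : ℝ) * n ^ 2 * p = t * n * (n * p) := by ring
        _ ≤ t * n * 1 := by gcongr
    have h₃ : (t : ℝ) * n ≤ startSlot d M k * n := by gcongr
    have h₄ : 0 ≤ (startSlot d M k : ℝ) * n := by positivity
    linarith
  obtain ⟨u, rfl⟩ := Nat.exists_eq_add_of_le' ht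
  obtain ⟨r, q, hq, rfl⟩ : ∃ r q, q < M * d ∧ u = r * (M * d) + q :=
    ⟨u / (M * d), u % (M * d), Nat.mod_lt _ hb, (Nat.div_add_mod' u (M * d)).symm⟩
  have hMk : M * k ≤ M * d := Nat.mul_le_mul_left M hkd
  -- Past the first Mk slots of a batch at most M(d - k) slots remain, which is within the delay.
  have hqmin : q ≤ min q (M * k) + startSlot d M k := by
    have : M * (d - k) + M * k = M * d := by rw [← mul_add, Nat.sub_add_cancel hkd]
    unfold startSlot
    omega
  -- In a bad batch the term with `badIndicator` compensates for the subtracted services, which are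
  -- guaranteed only in good batches.
  have hpoint : ∀ x : ℕ → SwitchMatrix n,
      (total (π.queue x (r * (M * d) + q + startSlot d M k)) : ℝ) ≤
        n * (((n * (M * d) : ℕ) : ℝ) * lyapunov n d M k r x) +
        (total (arrivalsIn x (r * (M * d)) (r * (M * d) + q + startSlot d M k)) : ℝ) +
        ((n * (M * d) : ℕ) : ℝ) * badIndicator d M k r x - n * (min q (M * k) : ℕ) := fun x => by
    have h₁ : (total (backlog d M k x r) : ℝ) ≤
        n * (((n * (M * d) : ℕ) : ℝ) * lyapunov n d M k r x) := by
      refine le_trans ?_ (mul_le_mul_of_nonneg_left (maxDeg_backlog_le_lyapunov hn hb r x) hnR.le)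
      exact_mod_cast total_le_mul_maxDeg _
    unfold badIndicator
    split_ifs with hgood
    · have h₂ : (total (π.queue x (r * (M * d) + q + startSlot d M k)) : ℝ) +
          n * (min q (M * k) : ℕ) ≤ total (backlog d M k x r) +
          total (arrivalsIn x (r * (M * d)) (r * (M * d) + q + startSlot d M k)) := by
        exact_mod_cast total_queue_le_of_good hkd hb (hπ x) hgood.1 q
      linarith
    · have h₂ : (total (π.queue x (r * (M * d) + q + startSlot d M k)) : ℝ) ≤
          total (backlog d M k x r) +
          total (arrivalsIn x (r * (M * d)) (r * (M * d) + q + startSlot d M k)) := by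
        exact_mod_cast total_queue_le hkd hb (hπ x) r q
      have h₃ : (n : ℝ) * (min q (M * k) : ℕ) ≤ ((n * (M * d) : ℕ) : ℝ) := by
        exact_mod_cast Nat.mul_le_mul_left n ((min_le_left _ _).trans hq.le)
      linarith
  have hi₁ := hX.integrable_comp (dependsOn_lyapunov (d := d) (M := M) (k := k) r)
  have hi₂ := hX.integrable_comp (dependsOn_badIndicator (d := d) (M := M) (k := k) r)
  have hi₃ := hX.integrable_comp (dependsOn_total_arrivalsIn (n := n) (r * (M * d))
    (r * (M * d) + q + startSlot d M k))
  have hi₄ := ((((hi₁.const_mul ((n * (M * d) : ℕ) : ℝ)).const_mul (n : ℝ)).add hi₃).add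
    (hi₂.const_mul ((n * (M * d) : ℕ) : ℝ)))
  refine (integral_mono (hX.integrable_comp (π.dependsOn_total_queue _))
    (hi₄.sub (integrable_const ((n : ℝ) * (min q (M * k) : ℕ)))) fun ω => hpoint _).trans ?_
  rw [integral_sub' hi₄ (integrable_const _), integral_add'
    (((hi₁.const_mul ((n * (M * d) : ℕ) : ℝ)).const_mul (n : ℝ)).add hi₃)
    (hi₂.const_mul ((n * (M * d) : ℕ) : ℝ)),
    integral_add' ((hi₁.const_mul ((n * (M * d) : ℕ) : ℝ)).const_mul (n : ℝ)) hi₃,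
    integral_const_mul, integral_const_mul, integral_const_mul,
    integral_total_arrivalsIn hX (by omega)]
  simp only [integral_const, probReal_univ, smul_eq_mul, one_mul]
  have hG := integral_lyapunov_le hX hn hb hε hbad hεW r
  have hB := hbad r
  set G := ∫ ω, lyapunov n d M k r (fun s => X s ω) ∂P
  set B := ∫ ω, badIndicator d M k r (fun s => X s ω) ∂P
  set W : ℝ := ((n * (M * d) : ℕ) : ℝ)
  have h₁ : (n : ℝ) * (W * G) ≤ n * (W * (4 * ε * (W + 1))) := by gcongr
  have h₂ : W * B ≤ W * ε := by gcongr
  have h₃ : W * ε ≤ n * (ε * (W + 1) * W) := by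
    have : W * ε * 1 ≤ W * ε * (n * (W + 1)) := by
      gcongr
      nlinarith
    linarith
  have h₄ : (((r * (M * d) + q + startSlot d M k : ℕ) : ℝ) - ((r * (M * d) : ℕ) : ℝ)) * n ^ 2 * p ≤
      (q + startSlot d M k) * n := by
    have : (((r * (M * d) + q + startSlot d M k : ℕ) : ℝ) - ((r * (M * d) : ℕ) : ℝ)) =
        q + startSlot d M k := by push_cast; ring
    rw [this]
    calc ((q : ℝ) + startSlot d M k) * n ^ 2 * p = (q + startSlot d M k) * n * (n * p) := by ring
      _ ≤ (q + startSlot d M k) * n * 1 := by gcongr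
      _ = _ := by ring
  have h₅ : (n : ℝ) * q ≤ n * ((min q (M * k) : ℕ) + startSlot d M k) := by
    gcongr
    exact_mod_cast hqmin
  linarith

end QueueBound

/-! ### Choice of the parameters. -/

section Parameters

variable {n : ℕ} {Ω : Type*} [MeasurableSpace Ω] {P : Measure Ω} [IsProbabilityMeasure P]
  {X : ℕ → Ω → SwitchMatrix n}

/-- A union bound over `M` ≤ 2n intervals and 2n rows and columns: 16 · 2n + 2n = 34n. -/
theorem integral_badIndicator_le {ρ : ℝ} (hX : BernoulliArray P (ρ / n) X) (hn : 2 ≤ n)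
    (hρ : ρ = 1 - 1 / n) {d M k : ℕ} {δ : ℝ} (hd : 18144 * Real.log n ≤ d) (hd0 : 0 < d)
    (hM0 : 0 < M) (hM : (M : ℝ) ≤ 2 * n) (hδ : 0 ≤ δ) (hδd : 1024 * (d * Real.log n) ≤ δ ^ 2)
    (hk : k = 0 ∨ (k : ℝ) ≤ ρ * d - δ)
    (hb : 240 * ((n : ℝ) ^ 2 * Real.log n) ≤ (M * d : ℕ)) (r : ℕ) :
    ∫ ω, badIndicator d M k r (fun s => X s ω) ∂P ≤
      34 * n * Real.exp (-(60 * Real.log n)) := by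
  have hn2 : (2 : ℝ) ≤ n := by exact_mod_cast hn
  have hinv : 1 / (n : ℝ) ≤ 1 / 2 := one_div_le_one_div_of_le (by norm_num) hn2
  have hinv0 : 0 ≤ 1 / (n : ℝ) := by positivity
  have hmeas : MeasurableSet {ω | ¬ GoodBatch d M k r fun s => X s ω} :=
    (measurableSet_setOfPred.2 (hX.measurable_comp (dependsOn_goodBatch r))).compl
  have hint : ∫ ω, badIndicator d M k r (fun s => X s ω) ∂P =
      P.real {ω | ¬ GoodBatch d M k r fun s => X s ω} := by
    rw [← integral_indicator_one hmeas]
    refine integral_congr_ae (ae_of_all _ fun ω => ?_)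
    by_cases h : GoodBatch d M k r fun s => X s ω <;> simp [badIndicator, Set.indicator, h]
  rw [hint]
  have hsub : {ω | ¬ GoodBatch d M k r fun s => X s ω} ⊆
      (⋃ m ∈ Finset.range M, {ω | ¬ FactorCondition (arrivalsIn (fun s => X s ω)
        (r * (M * d) + m * d) (r * (M * d) + m * d + d)) k}) ∪
      {ω | ¬ maxDeg (arrivalsIn (fun s => X s ω) (r * (M * d)) (r * (M * d) + M * d)) < M * d} := by
    intro ω hω
    by_contra hcon
    apply hω
    simp only [Set.mem_union, Set.mem_iUnion, Set.mem_ofPred_eq, not_or, not_exists, not_not,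
      Finset.mem_range] at hcon
    refine ⟨fun m hm => ?_, hcon.2⟩
    have := hcon.1 m hm
    rwa [intervalArrivals, add_mul, one_mul, ← add_assoc]
  refine (measureReal_mono hsub).trans ((measureReal_union_le _ _).trans ?_)
  have h₁ : P.real (⋃ m ∈ Finset.range M, {ω | ¬ FactorCondition (arrivalsIn (fun s => X s ω)
      (r * (M * d) + m * d) (r * (M * d) + m * d + d)) k}) ≤
      M * (16 * Real.exp (-(60 * Real.log n))) := by
    refine (measureReal_biUnion_finset_le _ _).trans ((Finset.sum_le_sum fun m _ =>
      prob_not_factorCondition_le hX (by omega) hd hd0 (by linarith) (by linarith) hδ hδd hk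
        (r * (M * d) + m * d)).trans ?_)
    simp
  have h₂ := prob_maxDeg_ge_le hX (by omega) (by linarith) hρ hb (Nat.mul_pos hM0 hd0)
    (r * (M * d))
  have h₃ : (M : ℝ) * (16 * Real.exp (-(60 * Real.log n))) ≤
      2 * n * (16 * Real.exp (-(60 * Real.log n))) := by gcongr
  linarith

theorem exists_policy_integral_total_queue_le (hn : 2 ≤ n) :
    ∃ π : SchedulingPolicy n, ∀ (Ω : Type*) [MeasurableSpace Ω] (P : Measure Ω)
      [IsProbabilityMeasure P] (X : ℕ → Ω → SwitchMatrix n),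
      BernoulliArray P ((1 - 1 / (n : ℝ)) / n) X → ∀ t,
        ∫ ω, (total (π.queue (fun s => X s ω) t) : ℝ) ∂P ≤
          2 ^ 20 * (n : ℝ) ^ (7 / 3 : ℝ) * Real.log n := by
  have hn2 : (2 : ℝ) ≤ n := by exact_mod_cast hn
  have hn0 : (0 : ℝ) < n := by linarith
  -- Writing h = n^(1/3) turns all fractional powers into integer powers of h.
  obtain ⟨h, hh1, hh3, hh7⟩ : ∃ h : ℝ, 1 ≤ h ∧ h ^ 3 = n ∧ (n : ℝ) ^ (7 / 3 : ℝ) = h ^ 7 := by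
    refine ⟨(n : ℝ) ^ (1 / 3 : ℝ), Real.one_le_rpow (by linarith) (by norm_num), ?_, ?_⟩
    · rw [← Real.rpow_natCast, ← Real.rpow_mul hn0.le]; norm_num
    · rw [← Real.rpow_natCast, ← Real.rpow_mul hn0.le]; norm_num
  have hh0 : 0 < h := by linarith
  set ℓ := Real.log n with hℓdef
  have hℓ : 1 / 2 ≤ ℓ := by
    have := Real.log_le_log (by norm_num) hn2
    have := Real.log_two_gt_d9
    linarith
  have hℓn : ℓ ≤ n := (Real.log_le_sub_one_of_pos hn0).trans (by linarith)
  have hexp : Real.exp (-(60 * ℓ)) = 1 / (n : ℝ) ^ 60 := by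
    rw [Real.exp_neg, one_div, hℓdef, show (60 : ℝ) = (60 : ℕ) by norm_num, Real.exp_nat_mul,
      Real.exp_log hn0]
  have hmono : ∀ a b : ℕ, a ≤ b → h ^ a ≤ h ^ b := fun a b hab => pow_le_pow_right₀ hh1 hab
  -- M ≈ h² and d ≈ h⁴ log n make Md of order n² log n; the factor 2^15 exceeds both 18144 and 240.
  obtain ⟨M, hMdef⟩ : ∃ M, M = ⌈h ^ 2⌉₊ := ⟨_, rfl⟩
  obtain ⟨d, hddef⟩ : ∃ d, d = ⌈2 ^ 15 * h ^ 4 * ℓ⌉₊ := ⟨_, rfl⟩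
  have hh2 : 1 ≤ h ^ 2 := one_le_pow₀ hh1
  have hh4 : 1 ≤ h ^ 4 := one_le_pow₀ hh1
  have hh4ℓ : 1 / 2 ≤ h ^ 4 * ℓ := by
    calc (1 : ℝ) / 2 = 1 * (1 / 2) := by ring
      _ ≤ h ^ 4 * ℓ := by gcongr
  have hM₁ : h ^ 2 ≤ M := hMdef ▸ Nat.le_ceil _
  have hM₂ : (M : ℝ) ≤ 2 * h ^ 2 := by
    have := Nat.ceil_lt_add_one (by positivity : 0 ≤ h ^ 2)
    rw [← hMdef] at this
    linarith
  have hd₁ : 2 ^ 15 * h ^ 4 * ℓ ≤ d := hddef ▸ Nat.le_ceil _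
  have hd₂ : (d : ℝ) ≤ 2 ^ 16 * (h ^ 4 * ℓ) := by
    have := Nat.ceil_lt_add_one (by positivity : 0 ≤ 2 ^ 15 * h ^ 4 * ℓ)
    rw [← hddef] at this
    linarith
  have hM0 : 0 < M := by exact_mod_cast (by linarith : (0 : ℝ) < M)
  have hdR : (0 : ℝ) < d := by linarith
  have hd0 : 0 < d := by exact_mod_cast hdR
  obtain ⟨δ, hδdef⟩ : ∃ δ, δ = 32 * Real.sqrt (d * ℓ) := ⟨_, rfl⟩
  have hδ0 : 0 ≤ δ := by rw [hδdef]; positivity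
  have hδ2 : 1024 * (d * ℓ) ≤ δ ^ 2 := by
    rw [hδdef, mul_pow, Real.sq_sqrt (by positivity)]; linarith
  have hδ₁ : δ ≤ 2 ^ 13 * (h ^ 2 * ℓ) := by
    have : Real.sqrt (d * ℓ) ≤ 2 ^ 8 * (h ^ 2 * ℓ) := by
      refine Real.sqrt_le_iff.2 ⟨by positivity, ?_⟩
      calc (d : ℝ) * ℓ ≤ 2 ^ 16 * (h ^ 4 * ℓ) * ℓ := by gcongr
        _ = (2 ^ 8 * (h ^ 2 * ℓ)) ^ 2 := by ring
    rw [hδdef]; linarith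
  -- A negative value is rounded to `k = 0`, for which the factor condition is void.
  obtain ⟨k, hkdef⟩ : ∃ k, k = ⌊(1 - 1 / (n : ℝ)) * d - δ⌋₊ := ⟨_, rfl⟩
  have hinv0 : 0 ≤ 1 / (n : ℝ) := by positivity
  have hk : k = 0 ∨ (k : ℝ) ≤ (1 - 1 / (n : ℝ)) * d - δ := by
    rcases le_total 0 ((1 - 1 / (n : ℝ)) * d - δ) with h0 | h0
    · exact Or.inr (hkdef ▸ Nat.floor_le h0)
    · exact Or.inl (hkdef ▸ Nat.floor_of_nonpos h0)
  have hk₁ : (1 - 1 / (n : ℝ)) * d - δ < k + 1 := hkdef ▸ Nat.lt_floor_add_one _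
  have hdn0 : 0 ≤ 1 / (n : ℝ) * d := by positivity
  have hkd : k ≤ d := by
    rcases hk with h0 | h0
    · omega
    · have : (k : ℝ) ≤ d := by linarith
      exact_mod_cast this
  have hMn : (M : ℝ) ≤ 2 * n := by
    have := hmono 2 3 (by norm_num)
    linarith
  have hMd : 240 * ((n : ℝ) ^ 2 * ℓ) ≤ (M * d : ℕ) := by
    push_cast
    calc 240 * ((n : ℝ) ^ 2 * ℓ) ≤ 2 ^ 15 * ((n : ℝ) ^ 2 * ℓ) := by gcongr; norm_num
      _ = h ^ 2 * (2 ^ 15 * h ^ 4 * ℓ) := by rw [← hh3]; ring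
      _ ≤ M * d := by gcongr
  have hd₃ : 18144 * ℓ ≤ d := by
    have : ℓ ≤ h ^ 4 * ℓ := le_mul_of_one_le_left (by linarith) hh4
    linarith
  have hW : ((n * (M * d) : ℕ) : ℝ) ≤ 2 ^ 17 * (n : ℝ) ^ 4 := by
    push_cast
    calc (n : ℝ) * (M * d) ≤ n * (2 * h ^ 2 * (2 ^ 16 * (h ^ 4 * n))) := by
          gcongr
          exact hd₂.trans (by gcongr)
      _ = 2 ^ 17 * (n ^ 2 * (h ^ 3) ^ 2) := by ring
      _ = 2 ^ 17 * (n : ℝ) ^ 4 := by rw [hh3]; ring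
  have hW₁ : ((n * (M * d) : ℕ) : ℝ) + 1 ≤ 2 ^ 18 * (n : ℝ) ^ 4 := by
    have : (1 : ℝ) ≤ (n : ℝ) ^ 4 := one_le_pow₀ (by linarith)
    linarith
  have hpow : ∀ a : ℕ, (2 : ℝ) ^ a ≤ (n : ℝ) ^ a := fun a =>
    pow_le_pow_left₀ (by norm_num) hn2 a
  have hε0 : 0 ≤ 34 * (n : ℝ) * (1 / (n : ℝ) ^ 60) := by positivity
  have hεW : 6 * (34 * n * (1 / (n : ℝ) ^ 60)) * (((n * (M * d) : ℕ) : ℝ) + 1) ≤ 1 := by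
    calc 6 * (34 * n * (1 / (n : ℝ) ^ 60)) * (((n * (M * d) : ℕ) : ℝ) + 1)
        ≤ 6 * (34 * n * (1 / (n : ℝ) ^ 60)) * (2 ^ 18 * (n : ℝ) ^ 4) := by gcongr
      _ = 204 * 2 ^ 18 / (n : ℝ) ^ 55 := by field_simp; ring
      _ ≤ 1 := by
        rw [div_le_one (by positivity)]
        exact le_trans (by norm_num) (hpow 55)
  have hεWW : 34 * n * (1 / (n : ℝ) ^ 60) * (((n * (M * d) : ℕ) : ℝ) + 1) *
      ((n * (M * d) : ℕ) : ℝ) ≤ 1 := by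
    calc 34 * n * (1 / (n : ℝ) ^ 60) * (((n * (M * d) : ℕ) : ℝ) + 1) * ((n * (M * d) : ℕ) : ℝ)
        ≤ 34 * n * (1 / (n : ℝ) ^ 60) * (2 ^ 18 * (n : ℝ) ^ 4) * (2 ^ 17 * (n : ℝ) ^ 4) := by
          gcongr
      _ = 34 * 2 ^ 35 / (n : ℝ) ^ 51 := by field_simp
      _ ≤ 1 := by
        rw [div_le_one (by positivity)]
        exact le_trans (by norm_num) (hpow 51)
  -- The contributions d, Md/n, Mδ and the rounding term M are at most 2^16, 2^17, 2^14 and 4 times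
  -- h⁴ log n.
  have hS : (startSlot d M k : ℝ) ≤ 2 ^ 18 * (h ^ 4 * ℓ) := by
    have hcast : (startSlot d M k : ℝ) = d + M * (d - k) := by
      rw [startSlot]; push_cast [Nat.cast_sub hkd]; ring
    have h₁ : (d : ℝ) - k ≤ 1 / n * d + δ + 1 := by linarith
    have h₂ : (M : ℝ) * (d - k) ≤ M * (1 / n * d + δ + 1) := by gcongr
    have h₃ : (M : ℝ) * (1 / n * d) ≤ 2 ^ 17 * (h ^ 4 * ℓ) := by
      calc (M : ℝ) * (1 / n * d) ≤ 2 * h ^ 2 * (1 / n * (2 ^ 16 * (h ^ 4 * ℓ))) := by gcongr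
        _ = 2 ^ 17 * (h ^ 3 * ℓ) := by rw [← hh3]; field_simp
        _ ≤ 2 ^ 17 * (h ^ 4 * ℓ) := by gcongr; norm_num
    have h₄ : (M : ℝ) * δ ≤ 2 ^ 14 * (h ^ 4 * ℓ) := by
      calc (M : ℝ) * δ ≤ 2 * h ^ 2 * (2 ^ 13 * (h ^ 2 * ℓ)) := by gcongr
        _ = 2 ^ 14 * (h ^ 4 * ℓ) := by ring
    have h₅ : (M : ℝ) ≤ 4 * (h ^ 4 * ℓ) := by
      have h₆ := hmono 2 4 (by norm_num)
      have h₇ : h ^ 4 * (1 / 2) ≤ h ^ 4 * ℓ := by gcongr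
      linarith
    rw [hcast]
    linarith
  obtain ⟨π, hπ⟩ := exists_policy_of_causal (fun t x => batchSchedule (n := n) d M k x t)
    (fun t x y hxy => batchSchedule_congr hkd hxy) fun t x => batchSchedule_feasible t
  refine ⟨π, fun Ω _ P _ X hX t => ?_⟩
  have hbad : ∀ r, ∫ ω, badIndicator d M k r (fun s => X s ω) ∂P ≤
      34 * n * (1 / (n : ℝ) ^ 60) := fun r => by
    rw [← hexp]
    exact integral_badIndicator_le hX hn rfl hd₃ hd0 hM0 hMn hδ0 hδ2 hk hMd r
  have hp : (n : ℝ) * ((1 - 1 / (n : ℝ)) / n) ≤ 1 := by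
    rw [mul_div_cancel₀ _ hn0.ne']; linarith
  refine (integral_total_queue_le hX (by omega) (Nat.mul_pos hM0 hd0) hkd hp hε0 hbad hεW hπ
    t).trans ?_
  have h₁ : 2 * (n : ℝ) * startSlot d M k ≤ 2 * n * (2 ^ 18 * (h ^ 4 * ℓ)) := by gcongr
  have h₂ : 5 * (n : ℝ) * (34 * n * (1 / (n : ℝ) ^ 60) * (((n * (M * d) : ℕ) : ℝ) + 1) *
      ((n * (M * d) : ℕ) : ℝ)) ≤ 5 * n * 1 := by gcongr
  have h₃ : (n : ℝ) * (h ^ 4 * ℓ) = h ^ 7 * ℓ := by rw [← hh3]; ring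
  have h₄ : (n : ℝ) * (1 / 2) ≤ n * (h ^ 4 * ℓ) := by gcongr
  rw [hh7]
  linarith

end Parameters

theorem corollary1 :
    ∃ c : ℝ, 0 < c ∧ ∀ n : ℕ, 1 ≤ n →
      ∃ π : SchedulingPolicy n,
        ∀ (Ω : Type*) [MeasurableSpace Ω] (P : Measure Ω) [IsProbabilityMeasure P]
          (ρ : ℝ) (p : unitInterval) (a : ℕ → Ω → SwitchMatrix n),
          ρ = 1 - 1 / (n : ℝ) → (p : ℝ) = ρ / (n : ℝ) → IsBernoulliArrivals P p a →
          ∀ t : ℕ,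
            Integrable (fun ω => ∑ i, ∑ j, (π.queue (fun s => a s ω) t i j : ℝ)) P ∧
            ∫ ω, ∑ i, ∑ j, (π.queue (fun s => a s ω) t i j : ℝ) ∂P ≤
              c * (n : ℝ) ^ (7 / 3 : ℝ) * Real.log (n : ℝ) := by
  refine ⟨2 ^ 20, by positivity, fun n hn => ?_⟩
  obtain ⟨π, hπ⟩ : ∃ π : SchedulingPolicy n, ∀ (Ω : Type _) [MeasurableSpace Ω] (P : Measure Ω)
      [IsProbabilityMeasure P] (X : ℕ → Ω → SwitchMatrix n),
      BernoulliArray P ((1 - 1 / (n : ℝ)) / n) X → ∀ t,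
        ∫ ω, (total (π.queue (fun s => X s ω) t) : ℝ) ∂P ≤
          2 ^ 20 * (n : ℝ) ^ (7 / 3 : ℝ) * Real.log n := by
    -- For n = 1 the arrival rate is `0` and so is log n; the queues stay empty under any policy.
    rcases hn.eq_or_lt with rfl | hn
    · refine ⟨⟨fun _ _ => 0, fun _ _ => by simp [feasibleSchedules]⟩, fun Ω _ P _ X hX t => ?_⟩
      refine (integral_total_queue_le_arrivals hX _ t).trans ?_
      simp
    · exact exists_policy_integral_total_queue_le hn
  refine ⟨π, fun Ω _ P _ ρ p a hρ hp ha t => ?_⟩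
  obtain ⟨X, hX, haX⟩ := ha.exists_bernoulliArray
  have hae : (fun ω => ∑ i, ∑ j, (π.queue (fun s => a s ω) t i j : ℝ)) =ᵐ[P]
      fun ω => (total (π.queue (fun s => X s ω) t) : ℝ) := by
    filter_upwards [haX] with ω hω
    rw [hω]
    simp [total]
  rw [hp, hρ] at hX
  refine ⟨(integrable_congr hae).2 (hX.integrable_comp (π.dependsOn_total_queue t)), ?_⟩
  rw [integral_congr_ae hae]
  exact hπ Ω P X hX t
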